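/- Let $r>0$ and let $X$ be a standard Brownian motion started at $0$ and reset to $0$ at the jump times of an independent Poisson process $N$ of intensity $r$; that is, $X(t)=B(t)-B(\tau_{N(t)})$, $t\ge 0$, where $B$ is a standard Brownian motion independent of $N$, $\tau_k$ is the time of the $k$-th jump of $N$ and $\tau_0=0$. Let $$L_r=\sup\{t\in[0,1] : X(t)=0\}$$ be the last zero of $X$ in $[0,1]$, and let $\gamma(s,x)=\int_0^x u^{s-1}e^{-u}\,du$ be the lower incomplete gamma function. Then $L_r$ has an absolutely continuous law, concentrated on $(0,1)$, with probability density $$p_{L_r}(t)=\frac{e^{-r}}{\pi\sqrt{t(1-t)}}+\frac{\sqrt r\,e^{r(t-1)}}{\pi\sqrt{1-t}}\,\gamma\!\left(\tfrac12,rt\right),\qquad 0<t<1 .$$ Equivalently, the law of $L_r$ is a mixture of two probability laws: for $0<t<1$, $$p_{L_r}(t)=e^{-r}\,p_L(t)+(1-e^{-r})\,p_X(r;t),$$ where $$p_L(t)=\frac1{\pi\sqrt{t(1-t)}},\qquad p_X(r;t)=\frac{\sqrt r}{\pi(e^{r}-1)}\,\frac{e^{rt}}{\sqrt{1-t}}\,\gamma\!\left(\tfrac12,rt\right)$$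 are both probability densities on $(0,1)$, the first being the density of the arcsine law. -/

import Mathlib

open MeasureTheory ProbabilityTheory Set
open scoped ENNReal NNReal

noncomputable section

namespace ResetBM

/-- `N` is a Poisson process of intensity `r` under `P`: a counting process (almost all paths are
nondecreasing, right-continuous and `ℕ`-valued) started at `0`, with independent and stationary
increments, whose value at time `t` is Poisson distributed with mean `r * t`. -/
structure IsPoissonProcess {Ω : Type*} [MeasurableSpace Ω] (N : ℝ≥0 → Ω → ℕ) (r : ℝ≥0)
    (P : Measure Ω) : Prop where
  monotone : ∀ᵐ ω ∂P, Monotone (fun t => N t ω)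
  rightCont : ∀ᵐ ω ∂P, ∀ t : ℝ≥0, ContinuousWithinAt (fun s => N s ω) (Ici t) t
  zero : ∀ᵐ ω ∂P, N 0 ω = 0
  indepIncrements : HasIndepIncrements (fun t ω => (N t ω : ℤ)) P
  stationary : ∀ s t : ℝ≥0,
    IdentDistrib (fun ω => (N (s + t) ω : ℤ) - (N s ω : ℤ)) (fun ω => (N t ω : ℤ) - (N 0 ω : ℤ)) P P
  law : ∀ t : ℝ≥0, HasLaw (N t) (poissonMeasure (r * t)) P

/-- The time `τ_k` of the `k`-th jump of a counting path `n`; `τ_0 = 0`. -/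
def jumpTime (n : ℝ≥0 → ℕ) (k : ℕ) : ℝ≥0 := sInf {s : ℝ≥0 | k ≤ n s}

/-- The path `b` reset to `0` at every jump of the counting path `n`: the time of the last reset
up to time `t` is `τ_{n t}` (or `0` if there was none), and since then the resetted path has
started afresh from `0` and followed the increments of `b`. -/
def resetPath (b : ℝ≥0 → ℝ) (n : ℝ≥0 → ℕ) (t : ℝ≥0) : ℝ := b t - b (jumpTime n (n t))

/-- `X` is a standard Brownian motion started at `0` under Poissonian resetting to `0` with
intensity `r`: it follows the increments of a Brownian motion `B` and is put back to `0` at the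
jump times of a Poisson process `N` of intensity `r` which is independent of `B`. (Given `N`, the
pieces of `X` between consecutive resets are independent Brownian motions started at `0`.) -/
def IsResetBrownian {Ω : Type*} [MeasurableSpace Ω] (X : ℝ≥0 → Ω → ℝ) (r : ℝ≥0)
    (P : Measure Ω) : Prop :=
  ∃ (B : ℝ≥0 → Ω → ℝ) (N : ℝ≥0 → Ω → ℕ),
    IsBrownianReal B P ∧ IsPoissonProcess N r P ∧
    IndepFun (fun ω t => B t ω) (fun ω t => N t ω) P ∧
    ∀ᵐ ω ∂P, ∀ t : ℝ≥0, X t ω = resetPath (fun s => B s ω) (fun s => N s ω) t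

/-- The last zero in `[0,1]` of a path, `sup {t ∈ [0,1] : x t = 0}`. -/
def lastZero (x : ℝ≥0 → ℝ) : ℝ := ((sSup {t : ℝ≥0 | t ≤ 1 ∧ x t = 0} : ℝ≥0) : ℝ)

/-- The lower incomplete gamma function `γ(s, x) = ∫_0^x u^(s-1) e^(-u) du`. -/
def lowerGamma (s x : ℝ) : ℝ := ∫ u in (0 : ℝ)..x, u ^ (s - 1) * Real.exp (-u)

/-- The measure on `ℝ` concentrated on `(0,1)` with density `p` there. -/
def lawOfDensity (p : ℝ → ℝ) : Measure ℝ :=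
  (volume.restrict (Ioo (0 : ℝ) 1)).withDensity (fun t => ENNReal.ofReal (p t))

/-- The density of the arcsine law on `(0,1)`. -/
def arcsinePDF (t : ℝ) : ℝ := 1 / (Real.pi * √(t * (1 - t)))

/-- The density, on `(0,1)`, of the last zero of reset Brownian motion. -/
def lastZeroPDF (r t : ℝ) : ℝ :=
  Real.exp (-r) / (Real.pi * √(t * (1 - t))) +
    √r * Real.exp (r * (t - 1)) * lowerGamma (1 / 2) (r * t) / (Real.pi * √(1 - t))

/-- The second component of the mixture, on `(0,1)`. -/
def resetPDF (r t : ℝ) : ℝ :=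
  √r / (Real.pi * (Real.exp r - 1)) * (Real.exp (r * t) / √(1 - t)) * lowerGamma (1 / 2) (r * t)

end ResetBM

end

/-!
Let `τ` be the time of the last reset before time `1`. The last zero of the reset path is less than
`t` exactly when `B` does not take the value `B τ` during `[t, 1]`.

For fixed `s < t`, put `X = B t - B s` and `Y = B 1 - B t`, two independent centred Gaussian
variables. Restarting `B` at its first return to `B s` after `t` makes the sign of `B 1 - B s`
symmetric on the event that there is a return; without a return that sign is the sign of `X`. So
the probability of no return is `E[sign X * sign (X + Y)]`, which by the symmetry of `Y` is
`P(|Y| < |X|)`. As `Y / X` is Cauchy distributed, this is `2 / π * arcsin √((t - s) / (1 - s))`,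
the distribution function of the arcsine law on `(s, 1)`.

By independence the law of the last zero is the average of these arcsine laws over the law of `τ`,
which has an atom of mass `e ^ (-r)` at `0` and the density `r * e ^ (-r * (1 - s))` on `(0, 1)`.
The atom contributes the arcsine component; the density contributes the term with the incomplete
gamma function.
-/

open Filter Topology TopologicalSpace

namespace ResetBM

/-! ### Level sets of continuous paths -/

section LevelSets

theorem exists_mem_eq_iff_denseSeq {ι E : Type*} [TopologicalSpace ι] [SecondCountableTopology ι]
    [MetricSpace E] {K : Set ι} (hK : IsCompact K) [Nonempty K] {x : ι → E}
    (hx : ContinuousOn x K) (y : E) :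
    (∃ u ∈ K, x u = y) ↔ ∀ n : ℕ, ∃ i, dist y (x (denseSeq K i)) < 1 / ((n : ℝ) + 1) := by
  have : CompactSpace K := isCompact_iff_compactSpace.1 hK
  have hcont : Continuous (K.domRestrict x) := hx.domRestrict
  have hrange : closure (range fun i => x (denseSeq K i)) = x '' K := by
    rw [← range_domRestrict]
    refine (closure_minimal (range_comp_subset_range _ _) (isCompact_range hcont).isClosed).antisymm
      ((hcont.range_subset_closure_image_dense (denseRange_denseSeq K)).trans_eq ?_)
    rw [← range_comp]
  exact iff_of_eq (congrArg (y ∈ ·) hrange.symm) |>.trans Metric.mem_closure_range_iff_nat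

theorem measurableSet_exists_mem_eq {ι Ω E : Type*} [TopologicalSpace ι]
    [SecondCountableTopology ι] [MeasurableSpace Ω] [MetricSpace E] [SecondCountableTopology E]
    [MeasurableSpace E] [BorelSpace E] {K : Set ι} (hK : IsCompact K) {x : ι → Ω → E}
    (hx : ∀ u ∈ K, Measurable (x u)) (hc : ∀ ω, ContinuousOn (fun u => x u ω) K)
    {y : Ω → E} (hy : Measurable y) : MeasurableSet {ω | ∃ u ∈ K, x u ω = y ω} := by
  rcases K.eq_empty_or_nonempty with rfl | hne
  · simp
  have : Nonempty K := hne.to_subtype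
  simp only [exists_mem_eq_iff_denseSeq hK (hc _), ofPred_forall, ofPred_exists]
  exact .iInter fun n => .iUnion fun i =>
    measurableSet_lt (hy.dist (hx _ (denseSeq K i).2)) measurable_const

/-- The space of continuous real paths on `ℝ≥0`, with the σ-algebra generated by evaluations. -/
abbrev ContinuousPath : Type := {b : ℝ≥0 → ℝ // Continuous b}

theorem measurableSet_exists_mem_Icc_eq (a c : ℝ≥0) :
    MeasurableSet {p : ℝ≥0 × ContinuousPath | ∃ u ∈ Icc a c, p.2.1 u = p.2.1 p.1} := by
  have heval (u : ℝ≥0) : Measurable fun b : ContinuousPath => b.1 u :=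
    (measurable_pi_apply u).comp measurable_subtype_coe
  refine measurableSet_exists_mem_eq (x := fun u (p : ℝ≥0 × ContinuousPath) => p.2.1 u)
    isCompact_Icc (fun u _ => (heval u).comp measurable_snd) (fun p => p.2.2.continuousOn) ?_
  exact measurable_uncurry_of_continuous_of_measurable (u := fun s (b : ContinuousPath) => b.1 s)
    (fun b => b.2) heval

end LevelSets

/-! ### Reset paths -/

section ResetPath

variable {n : ℝ≥0 → ℕ} {b : ℝ≥0 → ℝ} {s t : ℝ≥0}

theorem jumpTime_le_of_le_apply {k : ℕ} (h : k ≤ n s) : jumpTime n k ≤ s :=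
  csInf_le (OrderBot.bddBelow _) h

theorem jumpTime_apply_le (n : ℝ≥0 → ℕ) (t : ℝ≥0) : jumpTime n (n t) ≤ t :=
  jumpTime_le_of_le_apply le_rfl

theorem le_apply_jumpTime {k : ℕ} (hk : ∃ s, k ≤ n s)
    (hc : ∀ t : ℝ≥0, ContinuousWithinAt n (Ici t) t) : k ≤ n (jumpTime n k) := by
  have hmem : jumpTime n k ∈ closure {s : ℝ≥0 | k ≤ n s} :=
    csInf_mem_closure hk (OrderBot.bddBelow _)
  have hfreq : ∃ᶠ s in 𝓝[≥] jumpTime n k, k ≤ n s :=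
    frequently_nhdsWithin_iff.2 ((mem_closure_iff_frequently.1 hmem).mono fun s hs =>
      ⟨hs, jumpTime_le_of_le_apply hs⟩)
  have hconst : ∀ᶠ s in 𝓝[≥] jumpTime n k, n s = n (jumpTime n k) :=
    (hc _).eventually (IsOpen.mem_nhds (isOpen_discrete {n (jumpTime n k)}) rfl)
  obtain ⟨s, hks, hs⟩ := (hfreq.and_eventually hconst).exists
  exact hks.trans_eq hs

theorem jumpTime_apply_le_iff (hm : Monotone n) (hc : ∀ t : ℝ≥0, ContinuousWithinAt n (Ici t) t)
    (hst : s ≤ t) : jumpTime n (n t) ≤ s ↔ n s = n t where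
  mp h := (hm hst).antisymm ((le_apply_jumpTime ⟨t, le_rfl⟩ hc).trans (hm h))
  mpr h := jumpTime_le_of_le_apply h.ge

theorem resetPath_eq_sub (hm : Monotone n) (hc : ∀ t : ℝ≥0, ContinuousWithinAt n (Ici t) t)
    (hst : s ≤ t) (h : jumpTime n (n t) ≤ s) :
    resetPath b n s = b s - b (jumpTime n (n t)) := by
  rw [resetPath, (jumpTime_apply_le_iff hm hc hst).1 h]

theorem lastZero_lt_iff {x : ℝ≥0 → ℝ} {τ : ℝ≥0} (hτ : τ ≤ 1) (hxτ : x τ = 0)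
    (hc : ContinuousOn x (Icc τ 1)) :
    lastZero x < t ↔ ¬ ∃ u ∈ Icc t 1, x u = 0 := by
  set Z : Set ℝ≥0 := {u | u ≤ 1 ∧ x u = 0}
  have hbdd : BddAbove Z := ⟨1, fun _ h => h.1⟩
  have hτZ : τ ∈ Z := ⟨hτ, hxτ⟩
  rw [lastZero, NNReal.coe_lt_coe]
  constructor
  · rintro h ⟨u, hu, hxu⟩
    exact ((le_csSup hbdd ⟨hu.2, hxu⟩).trans_lt h).not_ge hu.1
  · intro hno
    set K : Set ℝ≥0 := Icc τ 1 ∩ x ⁻¹' {0}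
    have hK : IsCompact K := isCompact_Icc.of_isClosed_subset
      (hc.preimage_isClosed_of_isClosed isClosed_Icc isClosed_singleton) inter_subset_left
    have hτK : τ ∈ K := ⟨⟨le_rfl, hτ⟩, hxτ⟩
    have hsup : sSup K ∈ K := hK.sSup_mem ⟨τ, hτK⟩
    have hlt : sSup K < t := lt_of_not_ge fun hge => hno ⟨_, ⟨hge, hsup.1.2⟩, hsup.2⟩
    refine (csSup_le ⟨τ, hτZ⟩ fun u hu => ?_).trans_lt hlt
    rcases le_total u τ with h | h
    · exact h.trans (le_csSup hK.bddAbove hτK)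
    · exact le_csSup hK.bddAbove ⟨⟨h, hu.1⟩, hu.2⟩

theorem lastZero_resetPath_lt_iff (hm : Monotone n)
    (hc : ∀ t : ℝ≥0, ContinuousWithinAt n (Ici t) t) (hb : Continuous b) :
    lastZero (resetPath b n) < t ↔ ¬ ∃ u ∈ Icc t 1, b u = b (jumpTime n (n 1)) := by
  set τ := jumpTime n (n 1)
  have hτ : τ ≤ 1 := jumpTime_apply_le n 1
  have heq : EqOn (resetPath b n) (fun u => b u - b τ) (Icc τ 1) :=
    fun u hu => resetPath_eq_sub hm hc hu.2 hu.1
  have hzero : resetPath b n τ = 0 := (heq (left_mem_Icc.2 hτ)).trans (sub_self _)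
  rw [lastZero_lt_iff hτ hzero ((hb.sub continuous_const).continuousOn.congr heq)]
  refine not_congr ?_
  rcases le_total t τ with h | h
  · exact iff_of_true ⟨τ, ⟨h, hτ⟩, hzero⟩ ⟨τ, ⟨h, hτ⟩, rfl⟩
  · exact exists_congr fun u => and_congr_right fun hu => by
      rw [heq ⟨h.trans hu.1, hu.2⟩, sub_eq_zero]

/-- The time of the last jump up to time `1` of a counting path, computed from the values at
countably many times so that it is a measurable function of the path. -/
noncomputable def lastReset (n : ℝ≥0 → ℕ) : ℝ≥0 :=
  ⨅ i : ℕ, if n (denseSeq ℝ≥0 i) = n 1 then min (denseSeq ℝ≥0 i) 1 else 1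

theorem measurable_lastReset : Measurable lastReset :=
  .iInf fun _ => .ite (measurableSet_eq_fun (measurable_pi_apply _) (measurable_pi_apply _))
    measurable_const measurable_const

theorem lastReset_eq_jumpTime (hm : Monotone n) (hc : ∀ t : ℝ≥0, ContinuousWithinAt n (Ici t) t) :
    lastReset n = jumpTime n (n 1) := by
  have hτ := jumpTime_apply_le n 1
  apply le_antisymm
  · refine le_of_forall_gt fun c hc' => ?_
    rcases hτ.eq_or_lt with h | h
    · refine (ciInf_le (OrderBot.bddBelow _) 0).trans_lt (lt_of_le_of_lt ?_ (h ▸ hc'))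
      split_ifs <;> simp
    · obtain ⟨i, hi⟩ := (denseRange_denseSeq ℝ≥0).exists_mem_open
        (isOpen_Ioo (a := jumpTime n (n 1)) (b := min c 1)) (nonempty_Ioo.2 (lt_min hc' h))
      have hi1 := hi.2.trans_le (min_le_right _ _)
      refine (ciInf_le (OrderBot.bddBelow _) i).trans_lt ?_
      rw [if_pos ((jumpTime_apply_le_iff hm hc hi1.le).1 hi.1.le)]
      exact (min_le_left _ _).trans_lt (hi.2.trans_le (min_le_left _ _))
  · refine le_ciInf fun i => ?_
    split_ifs with h
    · exact le_min (jumpTime_le_of_le_apply h.ge) hτ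
    · exact hτ

end ResetPath

/-! ### Signs and ratios of Gaussian variables -/

section Sign

@[fun_prop]
theorem measurable_realSign : Measurable Real.sign :=
  .ite measurableSet_Iio measurable_const (.ite measurableSet_Ioi measurable_const measurable_const)

theorem abs_realSign_le_one (x : ℝ) : |Real.sign x| ≤ 1 := by
  rcases Real.sign_apply_eq x with h | h | h <;> simp [h]

theorem continuousAt_realSign {x : ℝ} (hx : x ≠ 0) : ContinuousAt Real.sign x := by
  rcases hx.lt_or_gt with h | h
  · exact continuousAt_const.congr <|
      (eventually_lt_nhds h).mono fun y hy => (Real.sign_of_neg hy).symm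
  · exact continuousAt_const.congr <|
      (eventually_gt_nhds h).mono fun y hy => (Real.sign_of_pos hy).symm

theorem realSign_mul_self {x : ℝ} (hx : x ≠ 0) : Real.sign x * Real.sign x = 1 := by
  rcases Real.sign_apply_eq_of_ne_zero x hx with h | h <;> simp [h]

theorem realSign_add_of_abs_lt {x y : ℝ} (h : |y| < |x|) : Real.sign (x + y) = Real.sign x := by
  rcases lt_or_ge x 0 with hx | hx
  · rw [abs_of_neg hx] at h
    rw [Real.sign_of_neg hx, Real.sign_of_neg (by linarith [le_abs_self y])]
  · rw [abs_of_nonneg hx] at h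
    rw [Real.sign_of_pos ((abs_nonneg y).trans_lt h),
      Real.sign_of_pos (by linarith [neg_abs_le y])]

theorem realSign_mul_add_realSign_mul_sub {x y : ℝ} (hxy : |y| ≠ |x|) :
    Real.sign x * Real.sign (x + y) + Real.sign x * Real.sign (x - y) =
      if |y| < |x| then 2 else 0 := by
  rcases hxy.lt_or_gt with h | h
  · rw [realSign_add_of_abs_lt h, sub_eq_add_neg, realSign_add_of_abs_lt (by rwa [abs_neg]),
      realSign_mul_self (abs_pos.1 ((abs_nonneg y).trans_lt h)), if_pos h]
    norm_num
  · rw [add_comm x, realSign_add_of_abs_lt h, ← neg_sub, Real.sign_neg, sub_eq_add_neg,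
      realSign_add_of_abs_lt (by rwa [abs_neg]), if_neg h.not_gt]
    ring

theorem integrable_realSign_mul_realSign {Ω : Type*} [MeasurableSpace Ω] {P : Measure Ω}
    [IsFiniteMeasure P] {f g : Ω → ℝ} (hf : Measurable f) (hg : Measurable g) :
    Integrable (fun ω => Real.sign (f ω) * Real.sign (g ω)) P :=
  .of_bound (by fun_prop : Measurable _).aestronglyMeasurable 1 <| ae_of_all _ fun ω => by
    simpa [abs_mul] using
      mul_le_one₀ (abs_realSign_le_one (f ω)) (abs_nonneg _) (abs_realSign_le_one (g ω))

theorem integral_realSign_mul_realSign_add {ρ : Measure (ℝ × ℝ)} [IsFiniteMeasure ρ]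
    (hρ : ρ.map (fun p => (p.1, -p.2)) = ρ) (hties : ∀ᵐ p ∂ρ, |p.2| ≠ |p.1|) :
    ∫ p, Real.sign p.1 * Real.sign (p.1 + p.2) ∂ρ = ρ.real {p | |p.2| < |p.1|} := by
  have hreflect : ∫ p, Real.sign p.1 * Real.sign (p.1 + p.2) ∂ρ =
      ∫ p, Real.sign p.1 * Real.sign (p.1 - p.2) ∂ρ := by
    conv_lhs => rw [← hρ]
    rw [integral_map (by fun_prop) (by fun_prop : Measurable _).aestronglyMeasurable]
    simp only [sub_eq_add_neg]
  have hmeas : MeasurableSet {p : ℝ × ℝ | |p.2| < |p.1|} :=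
    measurableSet_lt (by fun_prop) (by fun_prop)
  have hsum := calc
    ∫ p, Real.sign p.1 * Real.sign (p.1 + p.2) ∂ρ + ∫ p, Real.sign p.1 * Real.sign (p.1 - p.2) ∂ρ
      = ∫ p, Real.sign p.1 * Real.sign (p.1 + p.2) +
          Real.sign p.1 * Real.sign (p.1 - p.2) ∂ρ :=
        (integral_add (integrable_realSign_mul_realSign (by fun_prop) (by fun_prop))
          (integrable_realSign_mul_realSign (by fun_prop) (by fun_prop))).symm
    _ = ∫ p, {p : ℝ × ℝ | |p.2| < |p.1|}.indicator (fun _ => 2) p ∂ρ :=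
        integral_congr_ae (hties.mono fun p hp => realSign_mul_add_realSign_mul_sub hp)
    _ = 2 * ρ.real {p | |p.2| < |p.1|} := by
        rw [integral_indicator hmeas, setIntegral_const, smul_eq_mul, mul_comm]
  linarith only [hreflect, hsum]

end Sign

section GaussianRatio

theorem integral_abs_mul_exp_neg_mul_sq {β : ℝ} (hβ : 0 < β) :
    ∫ x : ℝ, |x| * Real.exp (-β * x ^ 2) = β⁻¹ := by
  have heven := integral_comp_abs (f := fun x => x * Real.exp (-β * x ^ 2))
  have hradial := integral_rpow_mul_exp_neg_mul_rpow (p := 2) (q := 1) two_pos (by norm_num) hβ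
  simp only [sq_abs] at heven
  simp only [Real.rpow_one, Real.rpow_two] at hradial
  rw [heven, hradial]
  norm_num [Real.rpow_neg_one]
  ring

theorem gaussianPDFReal_mul_gaussianPDFReal_div_sq (a b : ℝ≥0) (x z : ℝ) :
    gaussianPDFReal 0 a x * gaussianPDFReal 0 (b / .mk (x ^ 2) (sq_nonneg x)) z =
      (2 * Real.pi * √(a * b))⁻¹ * (|x| * Real.exp (-(((a : ℝ)⁻¹ + z ^ 2 / b) / 2) * x ^ 2)) := by
  have hvar : √(2 * Real.pi * (b / x ^ 2)) = √(2 * Real.pi * b) / |x| := by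
    rw [← mul_div_assoc, Real.sqrt_div (by positivity), Real.sqrt_sq_eq_abs]
  have hnorm : √(2 * Real.pi * a) * √(2 * Real.pi * b) = 2 * Real.pi * √(a * b) := by
    rw [← Real.sqrt_mul (by positivity), mul_mul_mul_comm, Real.sqrt_mul (by positivity),
      Real.sqrt_mul_self (by positivity)]
  have hexp : -x ^ 2 / (2 * a) + -z ^ 2 / (2 * (b / x ^ 2)) =
      -(((a : ℝ)⁻¹ + z ^ 2 / b) / 2) * x ^ 2 := by
    rw [← mul_div_assoc, div_div_eq_mul_div]
    ring
  simp only [gaussianPDFReal, NNReal.coe_div, NNReal.coe_mk, hvar, sub_zero]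
  rw [mul_mul_mul_comm, ← Real.exp_add, hexp, inv_div, ← hnorm, mul_inv]
  ring

theorem lintegral_gaussianPDF_mul_gaussianPDF_div_sq {a b : ℝ≥0} (ha : a ≠ 0) (hb : b ≠ 0)
    (z : ℝ) :
    ∫⁻ x, gaussianPDF 0 a x * gaussianPDF 0 (b / .mk (x ^ 2) (sq_nonneg x)) z =
      cauchyPDF 0 (NNReal.sqrt (b / a)) z := by
  have ha' : (0 : ℝ) < a := NNReal.coe_pos.2 ha.bot_lt
  have hb' : (0 : ℝ) < b := NNReal.coe_pos.2 hb.bot_lt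
  have hβ : 0 < ((a : ℝ)⁻¹ + z ^ 2 / b) / 2 := by positivity
  have hint : Integrable fun x : ℝ => |x| * Real.exp (-(((a : ℝ)⁻¹ + z ^ 2 / b) / 2) * x ^ 2) := by
    simpa [abs_mul] using (integrable_mul_exp_neg_mul_sq hβ).abs
  have hab : √((a : ℝ) * b) = a * √(b / a) := by
    rw [Real.sqrt_div hb'.le, Real.sqrt_mul ha'.le, mul_div_left_comm, Real.div_sqrt, mul_comm]
  have hγ := Real.sq_sqrt (div_pos hb' ha').le
  have : 0 < √((b : ℝ) / a) := by positivity
  simp only [gaussianPDF, ← ENNReal.ofReal_mul (gaussianPDFReal_nonneg _ _ _),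
    gaussianPDFReal_mul_gaussianPDFReal_div_sq]
  rw [← ofReal_integral_eq_lintegral_ofReal (hint.const_mul _) (ae_of_all _ fun x => by positivity),
    integral_const_mul, integral_abs_mul_exp_neg_mul_sq hβ, cauchyPDF, cauchyPDFReal,
    Real.coe_sqrt, NNReal.coe_div, hγ, hab, sub_zero]
  congr 1
  field_simp
  rw [hγ]
  field_simp
  ring

theorem map_div_prod_gaussianReal {a b : ℝ≥0} (ha : a ≠ 0) (hb : b ≠ 0) :
    ((gaussianReal 0 a).prod (gaussianReal 0 b)).map (fun p => p.2 / p.1) =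
      cauchyMeasure 0 (NNReal.sqrt (b / a)) := by
  have : NullSingletonClass (gaussianReal 0 a) := nullSingletonClass_gaussianReal ha
  have hfibre {s : Set ℝ} (hs : MeasurableSet s) {x : ℝ} (hx : x ≠ 0) :
      gaussianReal 0 b ((· / x) ⁻¹' s) =
        ∫⁻ z in s, gaussianPDF 0 (b / .mk (x ^ 2) (sq_nonneg x)) z := by
    rw [← Measure.map_apply (by fun_prop) hs, gaussianReal_map_div_const, zero_div,
      gaussianReal_apply _ (by simpa [hb, ← NNReal.coe_inj] using hx)]
  have hmeas : Measurable fun p : ℝ × ℝ =>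
      gaussianPDF 0 (b / .mk (p.1 ^ 2) (sq_nonneg p.1)) p.2 := by
    fun_prop
  ext s hs
  rw [cauchyMeasure_of_scale_ne_zero _ (by positivity), withDensity_apply _ hs,
    Measure.map_apply (by fun_prop) hs, Measure.prod_apply (by measurability)]
  calc ∫⁻ x, gaussianReal 0 b ((· / x) ⁻¹' s) ∂gaussianReal 0 a
      = ∫⁻ x, (∫⁻ z in s, gaussianPDF 0 (b / .mk (x ^ 2) (sq_nonneg x)) z) ∂gaussianReal 0 a :=
        lintegral_congr_ae ((Measure.ae_ne _ 0).mono fun x hx => hfibre hs hx)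
    _ = ∫⁻ x, ∫⁻ z in s, gaussianPDF 0 a x * gaussianPDF 0 (b / .mk (x ^ 2) (sq_nonneg x)) z := by
        rw [gaussianReal_of_var_ne_zero _ ha, lintegral_withDensity_eq_lintegral_mul _
          (measurable_gaussianPDF 0 a) hmeas.lintegral_prod_right']
        simp only [Pi.mul_apply, lintegral_const_mul _ (measurable_gaussianPDF _ _)]
    _ = ∫⁻ z in s, ∫⁻ x, gaussianPDF 0 a x * gaussianPDF 0 (b / .mk (x ^ 2) (sq_nonneg x)) z :=
        lintegral_lintegral_swap (by fun_prop)
    _ = ∫⁻ z in s, cauchyPDF 0 (NNReal.sqrt (b / a)) z := by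
        simp only [lintegral_gaussianPDF_mul_gaussianPDF_div_sq ha hb]

theorem cauchyMeasure_real_Ioo {γ : ℝ≥0} (hγ : γ ≠ 0) (x₀ : ℝ) {l u : ℝ} (hlu : l ≤ u) :
    (cauchyMeasure x₀ γ).real (Ioo l u) =
      Real.pi⁻¹ * (Real.arctan ((u - x₀) / γ) - Real.arctan ((l - x₀) / γ)) := by
  have hγ' : (γ : ℝ) ≠ 0 := NNReal.coe_ne_zero.2 hγ
  rw [measureReal_def, cauchyMeasure_of_scale_ne_zero _ hγ, withDensity_apply _ measurableSet_Ioo]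
  simp only [cauchyPDF]
  rw [← ofReal_integral_eq_lintegral_ofReal (integrable_cauchyPDFReal x₀).integrableOn
      (ae_of_all _ fun x => (cauchyPDF_pos x₀ hγ x).le),
    ENNReal.toReal_ofReal (integral_nonneg fun x => (cauchyPDF_pos x₀ hγ x).le),
    ← integral_Ioc_eq_integral_Ioo, ← intervalIntegral.integral_of_le hlu]
  simp only [cauchyPDFReal_def', intervalIntegral.integral_const_mul, sub_div]
  rw [intervalIntegral.integral_comp_div_sub (fun x => (1 + x ^ 2)⁻¹) hγ', integral_inv_one_add_sq,
    NNReal.coe_inv, smul_eq_mul, mul_assoc, inv_mul_cancel_left₀ hγ']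

theorem gaussianReal_prod_abs_lt_abs {a b : ℝ≥0} (ha : a ≠ 0) (hb : b ≠ 0) :
    ((gaussianReal 0 a).prod (gaussianReal 0 b)).real {p | |p.2| < |p.1|} =
      2 / Real.pi * Real.arctan √(a / b) := by
  have hratio : {p : ℝ × ℝ | |p.2| < |p.1|} =ᵐ[(gaussianReal 0 a).prod (gaussianReal 0 b)]
      (fun p => p.2 / p.1) ⁻¹' Ioo (-1) 1 := by
    have : NullSingletonClass (gaussianReal 0 a) := nullSingletonClass_gaussianReal ha
    filter_upwards [Measure.quasiMeasurePreserving_fst.ae (Measure.ae_ne (gaussianReal 0 a) 0)]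
      with p hp
    refine propext ?_
    change |p.2| < |p.1| ↔ p.2 / p.1 ∈ Ioo (-1) 1
    rw [mem_Ioo, ← abs_lt, abs_div, div_lt_one (abs_pos.2 hp)]
  rw [measureReal_congr hratio, ← map_measureReal_apply (by fun_prop) measurableSet_Ioo,
    map_div_prod_gaussianReal ha hb, cauchyMeasure_real_Ioo (by positivity) 0 (by norm_num)]
  simp only [sub_zero, neg_div, Real.arctan_neg, Real.coe_sqrt, NNReal.coe_div, one_div,
    ← Real.sqrt_inv, inv_div]
  ring

theorem gaussianReal_prod_ae_abs_ne_abs (a : ℝ≥0) {b : ℝ≥0} (hb : b ≠ 0) :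
    ∀ᵐ p ∂(gaussianReal 0 a).prod (gaussianReal 0 b), |p.2| ≠ |p.1| := by
  have : NullSingletonClass (gaussianReal 0 b) := nullSingletonClass_gaussianReal hb
  have hmeas : MeasurableSet {p : ℝ × ℝ | |p.2| ≠ |p.1|} :=
    (measurableSet_eq_fun (by fun_prop) (by fun_prop)).compl
  refine (Measure.ae_prod_iff_ae_ae hmeas).2 (ae_of_all _ fun x => ?_)
  filter_upwards [Measure.ae_ne _ x, Measure.ae_ne _ (-x)] with y hx hnx
  exact fun h => (abs_eq_abs.1 h).elim hx hnx

theorem integral_realSign_mul_realSign_add_gaussianReal {a : ℝ≥0} (ha : a ≠ 0) (b : ℝ≥0) :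
    ∫ p, Real.sign p.1 * Real.sign (p.1 + p.2) ∂(gaussianReal 0 a).prod (gaussianReal 0 b) =
      2 / Real.pi * Real.arcsin √(a / (a + b)) := by
  have ha' : (0 : ℝ) < a := NNReal.coe_pos.2 ha.bot_lt
  rcases eq_or_ne b 0 with rfl | hb
  · have : NullSingletonClass (gaussianReal 0 a) := nullSingletonClass_gaussianReal ha
    have hone : ∀ᵐ x ∂gaussianReal 0 a, Real.sign x * Real.sign x = 1 :=
      (Measure.ae_ne _ 0).mono fun x hx => realSign_mul_self hx
    rw [gaussianReal_zero_var, Measure.prod_dirac, integral_map (by fun_prop)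
      (by fun_prop : Measurable _).aestronglyMeasurable]
    simp only [add_zero]
    rw [integral_congr_ae hone]
    simp [ha'.ne']
  have hb' : (0 : ℝ) < b := NNReal.coe_pos.2 hb.bot_lt
  have hsymm : ((gaussianReal 0 a).prod (gaussianReal 0 b)).map (fun p => (p.1, -p.2)) =
      (gaussianReal 0 a).prod (gaussianReal 0 b) := by
    have := Measure.map_prod_map (gaussianReal 0 a) (gaussianReal 0 b) measurable_id measurable_neg
    rw [Measure.map_id, show (Neg.neg : ℝ → ℝ) = fun x => -x from rfl, gaussianReal_map_neg,
      neg_zero] at this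
    exact this.symm
  rw [integral_realSign_mul_realSign_add hsymm (gaussianReal_prod_ae_abs_ne_abs a hb),
    gaussianReal_prod_abs_lt_abs ha hb, Real.arctan_eq_arcsin, Real.sq_sqrt (by positivity),
    ← Real.sqrt_div (by positivity), one_add_div hb'.ne', div_div_div_cancel_right₀ hb'.ne',
    add_comm (b : ℝ)]

end GaussianRatio

/-! ### Zeros of Brownian motion -/

section CeilGrid

/-- The least multiple of `1 / (m + 1)` which is at least `x`, capped at `c`. -/
noncomputable def ceilGrid (c : ℝ≥0) (m : ℕ) (x : ℝ≥0) : ℝ≥0 :=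
  min (⌈x * (m + 1)⌉₊ / (m + 1)) c

theorem measurable_ceilGrid (c : ℝ≥0) (m : ℕ) : Measurable (ceilGrid c m) := by
  unfold ceilGrid
  fun_prop

theorem ceilGrid_le (c : ℝ≥0) (m : ℕ) (x : ℝ≥0) : ceilGrid c m x ≤ c := min_le_right _ _

theorem le_ceilGrid {c x : ℝ≥0} (h : x ≤ c) (m : ℕ) : x ≤ ceilGrid c m x :=
  le_min ((le_div_iff₀ (by positivity)).2 (Nat.le_ceil _)) h

theorem tendsto_ceilGrid {c x : ℝ≥0} (h : x ≤ c) :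
    Tendsto (fun m => ceilGrid c m x) atTop (𝓝 x) := by
  have hlim : Tendsto (fun m : ℕ => (⌈x * (m + 1)⌉₊ : ℝ≥0) / (m + 1)) atTop (𝓝 x) := by
    have hceil (m : ℕ) : ⌈(x : ℝ) * (m + 1)⌉₊ = ⌈x * (m + 1)⌉₊ :=
      Nonneg.nat_ceil_coe (x * ((m : ℝ≥0) + 1))
    rw [← NNReal.tendsto_coe]
    simpa [Function.comp_def, hceil] using (tendsto_nat_ceil_mul_div_atTop x.2).comp
      (tendsto_natCast_atTop_atTop.comp (tendsto_add_atTop_nat 1))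
  simpa only [ceilGrid, min_eq_left h] using hlim.min (tendsto_const_nhds (x := c))

theorem ceilGrid_mem_image {c x : ℝ≥0} (h : x ≤ c) (m : ℕ) :
    ceilGrid c m x ∈
      (Finset.range (⌈c * (m + 1)⌉₊ + 1)).image fun k : ℕ => min ((k : ℝ≥0) / (m + 1)) c :=
  Finset.mem_image.2 ⟨_, Finset.mem_range_succ_iff.2 (by gcongr), rfl⟩

end CeilGrid

section Filtration

variable {Ω : Type*} {m : MeasurableSpace Ω} {P : Measure Ω} {W : ℝ≥0 → Ω → ℝ}

theorem measurableSet_preimage_of_forall_le {ℱ : Filtration ℝ≥0 m} {T : Ω → ℝ≥0}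
    (hT : ∀ t, MeasurableSet[ℱ t] {ω | T ω ≤ t}) {t : ℝ≥0} {A : Set ℝ≥0} (hA : MeasurableSet A)
    (hAt : ∀ s ∈ A, s ≤ t) : MeasurableSet[ℱ t] (T ⁻¹' A) := by
  have hmin : Measurable[ℱ t] fun ω => min (T ω) t := by
    refine measurable_of_Iic fun s => ?_
    rcases le_or_gt t s with h | h
    · simp [preimage, h]
    · simpa [preimage, h.not_ge] using ℱ.mono h.le _ (hT s)
  have hinter : T ⁻¹' A = {ω | T ω ≤ t} ∩ (fun ω => min (T ω) t) ⁻¹' A := by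
    ext ω
    refine ⟨fun h => ⟨hAt _ h, ?_⟩, fun ⟨h, hA⟩ => ?_⟩
    · rwa [mem_preimage, min_eq_left (hAt _ h)]
    · rwa [mem_preimage, min_eq_left (by exact h)] at hA
  rw [hinter]
  exact MeasurableSet.inter (hT t) (hmin hA)

theorem integral_realSign_gaussianReal_zero (v : ℝ≥0) :
    ∫ x, Real.sign x ∂gaussianReal 0 v = 0 := by
  have h : ∫ x, Real.sign x ∂gaussianReal 0 v = -∫ x, Real.sign x ∂gaussianReal 0 v := by
    conv_lhs => rw [← neg_zero, ← gaussianReal_map_neg]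
    rw [integral_map (by fun_prop) measurable_realSign.aestronglyMeasurable]
    simp only [Real.sign_neg, integral_neg]
  linarith

variable {hWm : ∀ t, StronglyMeasurable (W t)}

theorem indepFun_sub_of_measurable_natural (hW : IsPreBrownianReal W P) {t c : ℝ≥0} (htc : t ≤ c)
    {E : Type*} [MeasurableSpace E] {Y : Ω → E} (hY : Measurable[Filtration.natural W hWm t] Y) :
    IndepFun Y (W c - W t) P := by
  have hinc : Measurable[.comap (fun ω u => W (t + u) ω - W t ω) inferInstance] (W c - W t) := by
    have heval : W c - W t = (fun x : ℝ≥0 → ℝ => x (c - t)) ∘ fun ω u => W (t + u) ω - W t ω := by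
      ext ω
      simp [add_tsub_cancel_of_le htc]
    exact heval ▸ (measurable_pi_apply _).comp (comap_measurable _)
  rw [Filtration.natural_eq_comap] at hY
  exact indep_of_indep_of_le_left
    (indep_of_indep_of_le_right (hW.indepFun_shift t).symm hinc.comap_le) hY.comap_le

theorem hasLaw_sub_of_le (hW : IsPreBrownianReal W P) {t c : ℝ≥0} (htc : t ≤ c) :
    HasLaw (W c - W t) (gaussianReal 0 (c - t)) P := by
  have hshift := (hW.shift t).hasLaw_eval (c - t)
  simp only [add_tsub_cancel_of_le htc] at hshift
  exact hshift

theorem integral_mul_realSign_sub (hW : IsPreBrownianReal W P) {t c : ℝ≥0} (htc : t ≤ c)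
    {Y : Ω → ℝ} (hY : Measurable[Filtration.natural W hWm t] Y) :
    ∫ ω, Y ω * Real.sign (W c ω - W t ω) ∂P = 0 := by
  have hlaw := hasLaw_sub_of_le hW htc
  have hsign : ∫ ω, Real.sign (W c ω - W t ω) ∂P = 0 := by
    rw [← integral_realSign_gaussianReal_zero (c - t), ← hlaw.map_eq,
      integral_map hlaw.aemeasurable measurable_realSign.aestronglyMeasurable]
    rfl
  have hind : IndepFun Y (fun ω => Real.sign (W c ω - W t ω)) P :=
    (indepFun_sub_of_measurable_natural hW htc hY).comp measurable_id measurable_realSign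
  have hm : Measurable fun ω => Real.sign (W c ω - W t ω) :=
    measurable_realSign.comp ((hWm c).measurable.sub (hWm t).measurable)
  rw [hind.integral_fun_mul_eq_mul_integral
    (hY.mono ((Filtration.natural W hWm).le t) le_rfl).aestronglyMeasurable
    hm.aestronglyMeasurable, hsign, mul_zero]

theorem integral_mul_realSign_sub_of_forall_mem_finset (hW : IsPreBrownianReal W P)
    {S : Finset ℝ≥0} {c : ℝ≥0} (hS : ∀ t ∈ S, t ≤ c) {T : Ω → ℝ≥0} (hTS : ∀ ω, T ω ∈ S)
    {Y : Ω → ℝ} (hYi : Integrable Y P)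
    (hY : ∀ t ∈ S, Measurable[Filtration.natural W hWm t] ({ω | T ω = t}.indicator Y)) :
    ∫ ω, Y ω * Real.sign (W c ω - W (T ω) ω) ∂P = 0 := by
  classical
  have hsum (ω : Ω) : Y ω * Real.sign (W c ω - W (T ω) ω) =
      ∑ t ∈ S, {ω | T ω = t}.indicator Y ω * Real.sign (W c ω - W t ω) := by
    rw [Finset.sum_eq_single_of_mem _ (hTS ω) fun t _ ht => by
      rw [indicator_of_notMem (by simpa using ht.symm), zero_mul], indicator_of_mem (by rfl)]
  have hint (t) (ht : t ∈ S) : Integrable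
      (fun ω => {ω | T ω = t}.indicator Y ω * Real.sign (W c ω - W t ω)) P := by
    refine hYi.mono ?_ (ae_of_all _ fun ω => ?_)
    · exact (((hY t ht).mono ((Filtration.natural W hWm).le t) le_rfl).mul (measurable_realSign.comp
        ((hWm c).measurable.sub (hWm t).measurable))).aestronglyMeasurable
    · rw [norm_mul]
      exact (mul_le_of_le_one_right (norm_nonneg _) (abs_realSign_le_one _)).trans
        (norm_indicator_le_norm_self Y ω)
  simp only [hsum]
  rw [integral_finsetSum _ hint]
  exact Finset.sum_eq_zero fun t ht => integral_mul_realSign_sub hW (hS t ht) (hY t ht)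

theorem measurable_indicator_ceilGrid_eq {ℱ : Filtration ℝ≥0 m} {a c t : ℝ≥0} {T : Ω → ℝ≥0}
    (hT : ∀ t, MeasurableSet[ℱ t] {ω | T ω ≤ t}) (haT : ∀ ω, a ≤ T ω) (hTc : ∀ ω, T ω ≤ c)
    {Y : Ω → ℝ} (hY : Measurable[ℱ a] Y) (k : ℕ) :
    Measurable[ℱ t] ({ω | ceilGrid c k (T ω) = t}.indicator Y) := by
  by_cases hat : a ≤ t
  · refine (hY.mono (ℱ.mono hat) le_rfl).indicator ?_
    have : {ω | ceilGrid c k (T ω) = t} = T ⁻¹' {x | x ≤ c ∧ ceilGrid c k x = t} := by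
      ext ω
      simp [hTc ω]
    rw [this]
    exact measurableSet_preimage_of_forall_le hT
      (measurableSet_Iic.inter (measurable_ceilGrid c k (measurableSet_singleton t)))
      fun s hs => hs.2 ▸ le_ceilGrid hs.1 k
  · have : {ω | ceilGrid c k (T ω) = t} = ∅ := by
      refine eq_empty_of_forall_notMem fun ω h => hat ?_
      exact (haT ω).trans ((le_ceilGrid (hTc ω) k).trans_eq h)
    simp [this]

theorem integral_mul_realSign_sub_stoppingTime (hW : IsPreBrownianReal W P)
    (hWc : ∀ ω, Continuous (W · ω)) {a c : ℝ≥0} {T : Ω → ℝ≥0}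
    (hT : ∀ t, MeasurableSet[Filtration.natural W hWm t] {ω | T ω ≤ t})
    (haT : ∀ ω, a ≤ T ω) (hTc : ∀ ω, T ω ≤ c)
    (hne : ∀ᵐ ω ∂P, T ω < c → W (T ω) ω ≠ W c ω) {Y : Ω → ℝ} (hYi : Integrable Y P)
    (hY : Measurable[Filtration.natural W hWm a] Y) :
    ∫ ω, Y ω * Real.sign (W c ω - W (T ω) ω) ∂P = 0 := by
  classical
  have hTm : Measurable T := measurable_of_Iic fun t => (Filtration.natural W hWm).le t _ (hT t)
  have hYm : Measurable Y := hY.mono ((Filtration.natural W hWm).le a) le_rfl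
  have hWT (k : ℕ) : Measurable fun ω => W (ceilGrid c k (T ω)) ω :=
    (measurable_uncurry_of_continuous_of_measurable hWc fun t => (hWm t).measurable).comp
      (((measurable_ceilGrid c k).comp hTm).prodMk measurable_id)
  have hzero (k : ℕ) : ∫ ω, Y ω * Real.sign (W c ω - W (ceilGrid c k (T ω)) ω) ∂P = 0 := by
    refine integral_mul_realSign_sub_of_forall_mem_finset (hWm := hWm) hW ?_
      (fun ω => ceilGrid_mem_image (hTc ω) k) hYi
      fun t _ => measurable_indicator_ceilGrid_eq hT haT hTc hY k
    simp only [Finset.mem_image, forall_exists_index, and_imp]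
    rintro _ j - rfl
    exact min_le_right _ _
  have hlim : Tendsto (fun k => ∫ ω, Y ω * Real.sign (W c ω - W (ceilGrid c k (T ω)) ω) ∂P) atTop
      (𝓝 (∫ ω, Y ω * Real.sign (W c ω - W (T ω) ω) ∂P)) := by
    refine tendsto_integral_of_dominated_convergence (fun ω => |Y ω|) (fun k => ?_) hYi.abs
      (fun k => ae_of_all _ fun ω => ?_) ?_
    · exact (hYm.mul (measurable_realSign.comp
        ((hWm c).measurable.sub (hWT k)))).aestronglyMeasurable
    · rw [norm_mul]
      exact mul_le_of_le_one_right (norm_nonneg _) (abs_realSign_le_one _)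
    · filter_upwards [hne] with ω hω
      refine Tendsto.const_mul _ ?_
      rcases (hTc ω).eq_or_lt with h | h
      · have (k : ℕ) : ceilGrid c k (T ω) = T ω :=
          ((ceilGrid_le c k _).trans h.ge).antisymm (le_ceilGrid (hTc ω) k)
        simp only [this, tendsto_const_nhds]
      · exact (continuousAt_realSign (sub_ne_zero.2 (hω h).symm)).tendsto.comp
          ((((hWc ω).tendsto _).comp (tendsto_ceilGrid (hTc ω))).const_sub _)
  simp only [hzero] at hlim
  exact tendsto_nhds_unique hlim tendsto_const_nhds

end Filtration

section HittingTime

theorem hittingBtwn_mem_of_isClosed {ι Ω E : Type*} [ConditionallyCompleteLinearOrder ι]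
    [TopologicalSpace ι] [OrderTopology ι] [TopologicalSpace E] {u : ι → Ω → E} {s : Set E}
    (hs : IsClosed s) {a c : ι} {ω : Ω} (hu : ContinuousOn (u · ω) (Icc a c))
    (h : ∃ j ∈ Icc a c, u j ω ∈ s) : u (hittingBtwn u s a c ω) ω ∈ s := by
  simp only [hittingBtwn_def, if_pos h]
  exact ((isCompact_Icc.of_isClosed_subset (hu.preimage_isClosed_of_isClosed isClosed_Icc hs)
    inter_subset_left).sInf_mem h).2

variable {Ω : Type*} {m : MeasurableSpace Ω} {P : Measure Ω} {W : ℝ≥0 → Ω → ℝ} {a c : ℝ≥0}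

theorem hittingBtwn_le_iff_of_continuous (hWc : ∀ ω, Continuous (W · ω)) {t : ℝ≥0} (htc : t < c)
    (ω : Ω) : hittingBtwn W {0} a c ω ≤ t ↔ ∃ u ∈ Icc a t, W u ω = 0 := by
  constructor
  · intro h
    obtain ⟨j, hj, hWj⟩ : ∃ j ∈ Icc a c, W j ω ∈ ({0} : Set ℝ) := by
      by_contra hno
      exact (hittingBtwn_eq_end_iff.2 fun hex => absurd hex hno).not_lt (h.trans_lt htc)
    exact ⟨_, ⟨le_hittingBtwn (hj.1.trans hj.2) ω, h⟩,
      hittingBtwn_mem_of_isClosed isClosed_singleton (hWc ω).continuousOn ⟨j, hj, hWj⟩⟩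
  · rintro ⟨u, hu, hWu⟩
    exact (hittingBtwn_le_of_mem hu.1 (hu.2.trans htc.le) hWu).trans hu.2

theorem measurableSet_hittingBtwn_le (hWm : ∀ t, StronglyMeasurable (W t))
    (hWc : ∀ ω, Continuous (W · ω)) (t : ℝ≥0) :
    MeasurableSet[Filtration.natural W hWm t] {ω | hittingBtwn W {0} a c ω ≤ t} := by
  rcases lt_or_ge t c with htc | htc
  · simp only [hittingBtwn_le_iff_of_continuous hWc htc]
    refine @measurableSet_exists_mem_eq _ _ _ _ _ (Filtration.natural W hWm t) _ _ _ _ _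
      isCompact_Icc _ (fun u hu => ?_) (fun ω => (hWc ω).continuousOn) _ measurable_const
    exact ((Filtration.stronglyAdapted_natural hWm u).measurable).mono
      ((Filtration.natural W hWm).mono hu.2) le_rfl
  · have : {ω | hittingBtwn W {0} a c ω ≤ t} = univ :=
      eq_univ_of_forall fun ω => (hittingBtwn_le ω).trans htc
    rw [this]
    exact MeasurableSet.univ

theorem realSign_mul_realSign_eq_one {x y : ℝ} (h : (0 : ℝ) ∉ uIcc x y) :
    Real.sign x * Real.sign y = 1 := by
  have hx : x ≠ 0 := fun h' => h (h' ▸ left_mem_uIcc)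
  have hy : y ≠ 0 := fun h' => h (h' ▸ right_mem_uIcc)
  rcases hx.lt_or_gt with h1 | h1 <;> rcases hy.lt_or_gt with h2 | h2
  · simp [Real.sign_of_neg h1, Real.sign_of_neg h2]
  · exact absurd (mem_uIcc.2 (Or.inl ⟨h1.le, h2.le⟩)) h
  · exact absurd (mem_uIcc.2 (Or.inr ⟨h2.le, h1.le⟩)) h
  · simp [Real.sign_of_pos h1, Real.sign_of_pos h2]

theorem indicator_not_exists_zero (hWc : ∀ ω, Continuous (W · ω)) (hac : a ≤ c) (ω : Ω) :
    {ω | ¬ ∃ u ∈ Icc a c, W u ω = 0}.indicator (1 : Ω → ℝ) ω =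
      Real.sign (W a ω) * Real.sign (W c ω) -
        Real.sign (W a ω) * Real.sign (W c ω - W (hittingBtwn W {0} a c ω) ω) := by
  by_cases h : ∃ u ∈ Icc a c, W u ω = 0
  · have hT : W (hittingBtwn W {0} a c ω) ω = 0 :=
      hittingBtwn_mem_of_isClosed isClosed_singleton (hWc ω).continuousOn h
    rw [indicator_of_notMem (not_not.2 h), hT, sub_zero, sub_self]
  · have hT : hittingBtwn W {0} a c ω = c := hittingBtwn_eq_end_iff.2 fun hex => absurd hex h
    have hivt : (0 : ℝ) ∉ uIcc (W a ω) (W c ω) := fun h0 => by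
      obtain ⟨u, hu, hWu⟩ := intermediate_value_uIcc (f := (W · ω)) (hWc ω).continuousOn h0
      exact h ⟨u, uIcc_of_le hac ▸ hu, hWu⟩
    rw [indicator_of_mem h, hT, sub_self, Real.sign_zero, mul_zero, sub_zero,
      realSign_mul_realSign_eq_one hivt, Pi.one_apply]

theorem ae_apply_ne_zero (hW : IsPreBrownianReal W P) (hc : c ≠ 0) : ∀ᵐ ω ∂P, W c ω ≠ 0 := by
  have := nullSingletonClass_gaussianReal (μ := 0) hc
  exact ((hW.hasLaw_eval c).ae_iff (p := (· ≠ 0)) (by measurability)).2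
    (Measure.ae_ne _ _)

theorem ae_apply_hittingBtwn_ne (hW : IsPreBrownianReal W P) (hWc : ∀ ω, Continuous (W · ω))
    (hc : c ≠ 0) :
    ∀ᵐ ω ∂P, hittingBtwn W {0} a c ω < c → W (hittingBtwn W {0} a c ω) ω ≠ W c ω := by
  filter_upwards [ae_apply_ne_zero hW hc] with ω hω hlt
  obtain ⟨u, hu, hWu⟩ := (hittingBtwn_le_iff_of_continuous hWc hlt ω).1 le_rfl
  have hT : W (hittingBtwn W {0} a c ω) ω = 0 :=
    hittingBtwn_mem_of_isClosed isClosed_singleton (hWc ω).continuousOn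
      ⟨u, ⟨hu.1, hu.2.trans hlt.le⟩, hWu⟩
  exact hT.trans_ne hω.symm

theorem measureReal_not_exists_zero_eq_integral (hW : IsPreBrownianReal W P)
    (hWm : ∀ t, StronglyMeasurable (W t)) (hWc : ∀ ω, Continuous (W · ω)) (hac : a ≤ c)
    (hc : c ≠ 0) :
    P.real {ω | ¬ ∃ u ∈ Icc a c, W u ω = 0} =
      ∫ ω, Real.sign (W a ω) * Real.sign (W c ω) ∂P := by
  have := hW.isGaussianProcess.isProbabilityMeasure
  have hm (t : ℝ≥0) : Measurable (W t) := (hWm t).measurable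
  have hT (t) := measurableSet_hittingBtwn_le (a := a) (c := c) hWm hWc t
  have hsub : Measurable fun ω => W c ω - W (hittingBtwn W {0} a c ω) ω :=
    (hm c).sub ((measurable_uncurry_of_continuous_of_measurable hWc hm).comp
      ((measurable_of_Iic fun t => (Filtration.natural W hWm).le t _ (hT t)).prodMk measurable_id))
  have hset : MeasurableSet {ω | ¬ ∃ u ∈ Icc a c, W u ω = 0} :=
    (measurableSet_exists_mem_eq isCompact_Icc (fun u _ => hm u) (fun ω => (hWc ω).continuousOn)
      measurable_const).compl
  have hzero : ∫ ω, Real.sign (W a ω) * Real.sign (W c ω - W (hittingBtwn W {0} a c ω) ω) ∂P = 0 :=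
    integral_mul_realSign_sub_stoppingTime (hWm := hWm) hW hWc hT
      (le_hittingBtwn hac) hittingBtwn_le (ae_apply_hittingBtwn_ne hW hWc hc)
      (.of_bound (measurable_realSign.comp (hm a)).aestronglyMeasurable 1
        (ae_of_all _ fun ω => abs_realSign_le_one _))
      (measurable_realSign.comp (Filtration.stronglyAdapted_natural hWm a).measurable)
  rw [← integral_indicator_one hset]
  simp only [indicator_not_exists_zero hWc hac]
  exact (integral_sub (integrable_realSign_mul_realSign (hm a) (hm c))
    (integrable_realSign_mul_realSign (hm a) hsub)).trans (by rw [hzero, sub_zero])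

theorem integral_realSign_mul_realSign_of_isPreBrownianReal (hW : IsPreBrownianReal W P)
    (hWm : ∀ t, StronglyMeasurable (W t)) (ha : a ≠ 0) (hac : a ≤ c) :
    ∫ ω, Real.sign (W a ω) * Real.sign (W c ω) ∂P = 2 / Real.pi * Real.arcsin √(a / c) := by
  have := hW.isGaussianProcess.isProbabilityMeasure
  have hind : IndepFun (W a) (W c - W a) P := indepFun_sub_of_measurable_natural (hWm := hWm) hW hac
    (Filtration.stronglyAdapted_natural hWm a).measurable
  have hlaw := hasLaw_sub_of_le hW hac
  have hmap := (indepFun_iff_map_prod_eq_prod_map_map (hW.aemeasurable a) hlaw.aemeasurable).1 hind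
  rw [(hW.hasLaw_eval a).map_eq, hlaw.map_eq] at hmap
  have hm : Measurable fun p : ℝ × ℝ => Real.sign p.1 * Real.sign (p.1 + p.2) := by fun_prop
  have h := integral_realSign_mul_realSign_add_gaussianReal ha (c - a)
  rw [← hmap, integral_map ((hW.aemeasurable a).prodMk hlaw.aemeasurable)
    hm.aestronglyMeasurable] at h
  simpa [← NNReal.coe_add, add_tsub_cancel_of_le hac] using h

end HittingTime

section ContinuousVersion

theorem measurable_of_continuous_of_dense {ι Ω E : Type*} [TopologicalSpace ι]
    [FrechetUrysohnSpace ι] [MeasurableSpace Ω] [TopologicalSpace E] [PseudoMetrizableSpace E]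
    [MeasurableSpace E] [BorelSpace E] {W : ι → Ω → E} (hWc : ∀ ω, Continuous (W · ω))
    {D : Set ι} (hD : Dense D) (hWm : ∀ t ∈ D, Measurable (W t)) (t : ι) : Measurable (W t) := by
  obtain ⟨u, hu, hlim⟩ := mem_closure_iff_seq_limit.1 (hD t)
  exact measurable_of_tendsto_metrizable (fun k => hWm _ (hu k))
    (tendsto_pi_nhds.2 fun ω => ((hWc ω).tendsto t).comp hlim)

theorem exists_measurable_continuous_version {ι Ω E : Type*} [TopologicalSpace ι]
    [FrechetUrysohnSpace ι] [SeparableSpace ι] [MeasurableSpace Ω] {P : Measure Ω}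
    [TopologicalSpace E] [PseudoMetrizableSpace E] [MeasurableSpace E] [BorelSpace E] [Nonempty E]
    {B : ι → Ω → E} (hBm : ∀ t, AEMeasurable (B t) P) (hBc : ∀ᵐ ω ∂P, Continuous (B · ω)) :
    ∃ W : ι → Ω → E, (∀ t, Measurable (W t)) ∧ (∀ ω, Continuous (W · ω)) ∧
      ∀ᵐ ω ∂P, ∀ t, W t ω = B t ω := by
  classical
  obtain ⟨D, hDc, hD⟩ := exists_countable_dense ι
  obtain ⟨G, hG, hGm, hGmem⟩ : ∃ G : Set Ω, (∀ ω ∈ G, Continuous (B · ω) ∧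
      ∀ t ∈ D, B t ω = (hBm t).mk (B t) ω) ∧ MeasurableSet G ∧ ∀ᵐ ω ∂P, ω ∈ G := by
    obtain ⟨G, hG, hGm, hGnull⟩ := exists_measurable_superset_of_null <| ae_iff.1 <|
      hBc.and ((ae_ball_iff hDc).2 fun t _ => (hBm t).ae_eq_mk)
    exact ⟨Gᶜ, fun ω hω => by_contra fun h => hω (hG h), hGm.compl,
      measure_eq_zero_iff_ae_notMem.1 hGnull⟩
  let x₀ : E := Classical.arbitrary E
  have hc (ω) : Continuous fun t => if ω ∈ G then B t ω else x₀ := by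
    by_cases h : ω ∈ G
    · simpa only [h, if_true] using (hG ω h).1
    · simpa only [h, if_false] using continuous_const
  refine ⟨fun t ω => if ω ∈ G then B t ω else x₀,
    measurable_of_continuous_of_dense hc hD fun t ht => ?_, hc, ?_⟩
  · have hmk : (fun ω => if ω ∈ G then B t ω else x₀) =
        fun ω => if ω ∈ G then (hBm t).mk (B t) ω else x₀ :=
      funext fun ω => ite_congr rfl (fun h => (hG ω h).2 t ht) fun _ => rfl
    exact hmk ▸ Measurable.ite hGm (hBm t).measurable_mk measurable_const
  · filter_upwards [hGmem] with ω hω t using if_pos hω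

end ContinuousVersion

section NoReturn

variable {Ω : Type*} [MeasurableSpace Ω] {P : Measure Ω} {W : ℝ≥0 → Ω → ℝ}

theorem exists_mem_Icc_eq_iff_shift {w : ℝ≥0 → ℝ} {s t c : ℝ≥0} (hst : s ≤ t)
    (hsc : s ≤ c) :
    (∃ u ∈ Icc t c, w u = w s) ↔ ∃ v ∈ Icc (t - s) (c - s), w (s + v) - w s = 0 := by
  simp only [sub_eq_zero]
  constructor
  · rintro ⟨u, hu, h⟩
    refine ⟨u - s, ⟨tsub_le_tsub_right hu.1 s, tsub_le_tsub_right hu.2 s⟩, ?_⟩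
    rwa [add_tsub_cancel_of_le (hst.trans hu.1)]
  · rintro ⟨v, hv, h⟩
    exact ⟨s + v, ⟨tsub_le_iff_left.1 hv.1, (le_tsub_iff_left hsc).1 hv.2⟩, h⟩

theorem measureReal_not_exists_return (hW : IsPreBrownianReal W P) (hWm : ∀ t, Measurable (W t))
    (hWc : ∀ ω, Continuous (W · ω)) {s t c : ℝ≥0} (hst : s < t) (htc : t ≤ c) :
    P.real {ω | ¬ ∃ u ∈ Icc t c, W u ω = W s ω} =
      2 / Real.pi * Real.arcsin √((t - s) / (c - s)) := by
  have hV := hW.shift s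
  have hVm (u : ℝ≥0) : StronglyMeasurable fun ω => W (s + u) ω - W s ω :=
    ((hWm _).sub (hWm _)).stronglyMeasurable
  have hts : t - s ≤ c - s := tsub_le_tsub_right htc s
  have hts0 : t - s ≠ 0 := (tsub_pos_of_lt hst).ne'
  have hcs0 : c - s ≠ 0 := (tsub_pos_of_lt (hst.trans_le htc)).ne'
  simp only [exists_mem_Icc_eq_iff_shift hst.le (hst.le.trans htc)]
  rw [measureReal_not_exists_zero_eq_integral hV hVm (fun ω => by have := hWc ω; fun_prop) hts hcs0,
    integral_realSign_mul_realSign_of_isPreBrownianReal hV hVm hts0 hts,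
    NNReal.coe_sub hst.le, NNReal.coe_sub (hst.le.trans htc)]

end NoReturn

/-! ### The arcsine law and the law of the last reset -/

section ArcsineLaw

/-- The arcsine law on `(s, 1)`: the law of the last zero in `[s, 1]` of a Brownian motion started
from `0` at time `s`. -/
noncomputable def arcsineLaw (s : ℝ) : Measure ℝ :=
  (volume.restrict (Ioo s 1)).withDensity
    fun v => ENNReal.ofReal (1 / (Real.pi * √((v - s) * (1 - v))))

theorem hasDerivAt_arcsin_sqrt {x : ℝ} (h0 : 0 < x) (h1 : x < 1) :
    HasDerivAt (fun x => 2 * Real.arcsin √x) (1 / √(x * (1 - x))) x := by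
  have hsqrt : √x < 1 := (Real.sqrt_lt' one_pos).2 (by rwa [one_pow])
  have hd := ((Real.hasDerivAt_arcsin (by linarith [Real.sqrt_nonneg x]) hsqrt.ne).comp x
    (Real.hasDerivAt_sqrt h0.ne')).const_mul 2
  refine hd.congr_deriv ?_
  rw [Real.sq_sqrt h0.le, Real.sqrt_mul h0.le]
  ring

theorem hasDerivAt_arcsin_sqrt_div {s v : ℝ} (hsv : s < v) (hv : v < 1) :
    HasDerivAt (fun v => 2 / Real.pi * Real.arcsin √((v - s) / (1 - s)))
      (1 / (Real.pi * √((v - s) * (1 - v)))) v := by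
  have hs : 0 < 1 - s := by linarith
  have hd := ((hasDerivAt_arcsin_sqrt (div_pos (sub_pos.2 hsv) hs)
    ((div_lt_one hs).2 (by linarith))).comp v
      (((hasDerivAt_id v).sub_const s).div_const (1 - s))).const_mul (Real.pi⁻¹)
  have hsqrt : √((v - s) / (1 - s) * (1 - (v - s) / (1 - s))) =
      √((v - s) * (1 - v)) / (1 - s) := by
    rw [one_sub_div hs.ne', sub_sub_sub_cancel_right, div_mul_div_comm,
      Real.sqrt_div' _ (by positivity), Real.sqrt_mul_self hs.le]
  refine (hd.congr_deriv ?_).congr_of_eventuallyEq (.of_eq (funext fun v => ?_))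
  · rw [hsqrt]
    field_simp
  · simp only [Function.comp_apply, id]
    ring

theorem setLIntegral_arcsine {s t : ℝ} (hst : s ≤ t) (ht : t ≤ 1) :
    ∫⁻ v in Ioo s t, ENNReal.ofReal (1 / (Real.pi * √((v - s) * (1 - v)))) =
      ENNReal.ofReal (2 / Real.pi * Real.arcsin √((t - s) / (1 - s))) := by
  have hcont : ContinuousOn (fun v => 2 / Real.pi * Real.arcsin √((v - s) / (1 - s))) (Icc s t) :=
    have := Real.continuous_arcsin
    by fun_prop
  have hderiv (v) (hv : v ∈ Ioo s t) := hasDerivAt_arcsin_sqrt_div hv.1 (hv.2.trans_le ht)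
  have hnonneg (v : ℝ) : 0 ≤ 1 / (Real.pi * √((v - s) * (1 - v))) := by positivity
  have hint := intervalIntegral.integrableOn_deriv_of_nonneg hcont hderiv fun v _ => hnonneg v
  rw [← ofReal_integral_eq_lintegral_ofReal (hint.mono_set Ioo_subset_Ioc_self)
    (ae_of_all _ hnonneg), ← integral_Ioc_eq_integral_Ioo, ← intervalIntegral.integral_of_le hst,
    intervalIntegral.integral_eq_sub_of_hasDerivAt_of_le hst hcont hderiv
      ((intervalIntegrable_iff_integrableOn_Ioc_of_le hst).2 hint)]
  simp only [sub_self, zero_div, Real.sqrt_zero, Real.arcsin_zero, mul_zero, sub_zero]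

-- For `t ∉ [s, 1]` this holds because `√` and `Real.arcsin` are constant outside their domains.
theorem arcsineLaw_Iio {s : ℝ} (hs : s < 1) (t : ℝ) :
    arcsineLaw s (Iio t) = ENNReal.ofReal (2 / Real.pi * Real.arcsin √((t - s) / (1 - s))) := by
  have hs' : 0 < 1 - s := sub_pos.2 hs
  rw [arcsineLaw, withDensity_apply _ measurableSet_Iio,
    Measure.restrict_restrict measurableSet_Iio, inter_comm, Ioo_inter_Iio]
  rcases le_total t s with hts | hst
  · have hsqrt : √((t - s) / (1 - s)) = 0 :=
      Real.sqrt_eq_zero_of_nonpos (div_nonpos_of_nonpos_of_nonneg (sub_nonpos.2 hts) hs'.le)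
    rw [Ioo_eq_empty (not_lt.2 ((min_le_right _ _).trans hts)), hsqrt]
    simp
  rcases le_total t 1 with ht | ht
  · rw [min_eq_right ht, setLIntegral_arcsine hst ht]
  · have hsqrt : 1 ≤ √((t - s) / (1 - s)) :=
      Real.one_le_sqrt.2 ((one_le_div hs').2 (sub_le_sub_right ht s))
    rw [min_eq_left ht, setLIntegral_arcsine hs.le le_rfl, div_self hs'.ne', Real.sqrt_one,
      Real.arcsin_of_one_le hsqrt, Real.arcsin_one]

theorem isProbabilityMeasure_arcsineLaw {s : ℝ} (hs : s < 1) :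
    IsProbabilityMeasure (arcsineLaw s) := by
  constructor
  rw [arcsineLaw, withDensity_apply _ .univ, Measure.restrict_univ,
    setLIntegral_arcsine hs.le le_rfl, div_self (sub_pos.2 hs).ne', Real.sqrt_one, Real.arcsin_one,
    div_mul_div_comm, mul_comm 2, div_self (by positivity), ENNReal.ofReal_one]

theorem lawOfDensity_arcsinePDF : lawOfDensity arcsinePDF = arcsineLaw 0 := by
  simp only [lawOfDensity, arcsinePDF, arcsineLaw, sub_zero]

end ArcsineLaw

section LastResetLaw

/-- The law of the last jump before time `1` of a Poisson process of intensity `r`, with the mass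
`e^{-r}` of the event that there is no jump placed at `0`. -/
noncomputable def lastResetLaw (r : ℝ) : Measure ℝ :=
  ENNReal.ofReal (Real.exp (-r)) • Measure.dirac 0 +
    (volume.restrict (Ioo 0 1)).withDensity
      fun s => ENNReal.ofReal (r * Real.exp (-(r * (1 - s))))

instance (r : ℝ) : SFinite (lastResetLaw r) := by unfold lastResetLaw; infer_instance

theorem setLIntegral_mul_exp {r c : ℝ} (hr : 0 ≤ r) (hc : 0 ≤ c) :
    ∫⁻ s in Ioo 0 c, ENNReal.ofReal (r * Real.exp (-(r * (1 - s)))) =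
      ENNReal.ofReal (Real.exp (-(r * (1 - c))) - Real.exp (-r)) := by
  have hcont : Continuous fun s => r * Real.exp (-(r * (1 - s))) := by fun_prop
  have hderiv (s : ℝ) : HasDerivAt (fun s => Real.exp (-(r * (1 - s))))
      (r * Real.exp (-(r * (1 - s)))) s := by
    simpa [mul_comm] using (((hasDerivAt_id' s).const_sub 1).const_mul r).fun_neg.exp
  rw [← ofReal_integral_eq_lintegral_ofReal (hcont.integrableOn_Ioc.mono_set Ioo_subset_Ioc_self)
    (ae_of_all _ fun s => by positivity), ← integral_Ioc_eq_integral_Ioo,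
    ← intervalIntegral.integral_of_le hc, intervalIntegral.integral_eq_sub_of_hasDerivAt
      (fun s _ => hderiv s) (hcont.intervalIntegrable _ _), sub_zero, mul_one]

theorem ae_lastResetLaw_mem_Ico (r : ℝ) : ∀ᵐ s ∂lastResetLaw r, s ∈ Ico (0 : ℝ) 1 := by
  rw [lastResetLaw, ae_add_measure_iff]
  refine ⟨Measure.ae_smul_measure ?_ _, (withDensity_absolutelyContinuous _ _).ae_le ?_⟩
  · exact (ae_dirac_iff measurableSet_Ico).2 ⟨le_rfl, one_pos⟩
  · exact (ae_restrict_mem measurableSet_Ioo).mono fun s hs => Ioo_subset_Ico_self hs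

theorem lastResetLaw_Iic_of_neg (r : ℝ) {a : ℝ} (ha : a < 0) : lastResetLaw r (Iic a) = 0 :=
  measure_eq_zero_iff_ae_notMem.2 <|
    (ae_lastResetLaw_mem_Ico r).mono fun _ hs h => (h.trans_lt ha).not_ge hs.1

theorem lastResetLaw_Iic {r a : ℝ} (hr : 0 ≤ r) (ha : 0 ≤ a) :
    lastResetLaw r (Iic a) = ENNReal.ofReal (Real.exp (-(r * (1 - min a 1)))) := by
  have hae : (Iic a ∩ Ioo 0 1 : Set ℝ) =ᵐ[volume] Ioo 0 (min a 1) := by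
    rw [min_comm, ← Ioo_inter_Iio, inter_comm]
    exact (ae_eq_refl _).inter Iio_ae_eq_Iic.symm
  have hexp : Real.exp (-r) ≤ Real.exp (-(r * (1 - min a 1))) :=
    Real.exp_le_exp.2 <| neg_le_neg <| mul_le_of_le_one_right hr <|
      sub_le_self _ (le_min ha zero_le_one)
  rw [lastResetLaw, Measure.add_apply, Measure.smul_apply, withDensity_apply _ measurableSet_Iic,
    Measure.restrict_restrict measurableSet_Iic, setLIntegral_congr hae,
    setLIntegral_mul_exp hr (le_min ha zero_le_one), Measure.dirac_apply' _ measurableSet_Iic,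
    indicator_of_mem (by exact ha), Pi.one_apply, smul_eq_mul, mul_one,
    ← ENNReal.ofReal_add (Real.exp_nonneg _) (sub_nonneg.2 hexp), add_sub_cancel]

theorem isProbabilityMeasure_lastResetLaw {r : ℝ} (hr : 0 ≤ r) :
    IsProbabilityMeasure (lastResetLaw r) := by
  constructor
  rw [lastResetLaw, Measure.add_apply, Measure.smul_apply, withDensity_apply _ .univ,
    Measure.restrict_univ, setLIntegral_mul_exp hr zero_le_one, measure_univ, smul_eq_mul, mul_one,
    ← ENNReal.ofReal_add (Real.exp_nonneg _) (by simpa using hr)]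
  simp

end LastResetLaw

section Mixture

theorem lowerGamma_nonneg (s : ℝ) {x : ℝ} (hx : 0 ≤ x) : 0 ≤ lowerGamma s x :=
  intervalIntegral.integral_nonneg hx fun _ hu =>
    mul_nonneg (Real.rpow_nonneg hu.1 _) (Real.exp_nonneg _)

theorem one_div_sqrt_eq_rpow {x : ℝ} (hx : 0 ≤ x) : 1 / √x = x ^ ((1 / 2 : ℝ) - 1) := by
  rw [Real.sqrt_eq_rpow, one_div, ← Real.rpow_neg hx]
  norm_num

theorem intervalIntegrable_exp_div_sqrt_sub (r : ℝ) {v : ℝ} (hv : 0 ≤ v) :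
    IntervalIntegrable (fun s => Real.exp (r * s) / √(v - s)) volume 0 v := by
  have hrpow : IntervalIntegrable (fun s : ℝ => (v - s) ^ ((1 / 2 : ℝ) - 1)) volume 0 v := by
    simpa using ((intervalIntegral.intervalIntegrable_rpow' (a := 0) (b := v)
      (r := (1 / 2 : ℝ) - 1) (by norm_num)).comp_sub_left v).symm
  refine (hrpow.mul_continuousOn (g := fun s => Real.exp (r * s)) (by fun_prop)).congr
    fun s hs => ?_
  rw [uIoc_of_le hv] at hs
  simp only [← one_div_sqrt_eq_rpow (sub_nonneg.2 hs.2)]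
  ring

theorem sqrt_mul_integral_exp_div_sqrt_sub {r v : ℝ} (hr : 0 ≤ r) (hv : 0 ≤ v) :
    √r * ∫ s in (0 : ℝ)..v, Real.exp (r * s) / √(v - s) =
      Real.exp (r * v) * lowerGamma (1 / 2) (r * v) := by
  rcases hr.eq_or_lt with rfl | hr
  · simp [lowerGamma]
  have hintegrand (s) (hs : s ∈ uIcc 0 v) : Real.exp (r * s) / √(v - s) =
      √r * Real.exp (r * v) *
        ((r * v - r * s) ^ ((1 / 2 : ℝ) - 1) * Real.exp (-(r * v - r * s))) := by
    rw [uIcc_of_le hv] at hs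
    rw [← mul_sub, ← one_div_sqrt_eq_rpow (mul_nonneg hr.le (sub_nonneg.2 hs.2)),
      Real.sqrt_mul hr.le, show r * s = r * v + -(r * (v - s)) by ring, Real.exp_add]
    field_simp
  rw [intervalIntegral.integral_congr hintegrand, intervalIntegral.integral_const_mul,
    intervalIntegral.integral_comp_sub_mul (fun u => u ^ ((1 / 2 : ℝ) - 1) * Real.exp (-u)) hr.ne',
    mul_zero, sub_zero, sub_self, smul_eq_mul, ← lowerGamma,
    mul_assoc, ← mul_assoc √r, Real.mul_self_sqrt hr.le, mul_left_comm, mul_inv_cancel_left₀ hr.ne']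

theorem setLIntegral_mul_exp_mul_arcsine {r v : ℝ} (hr : 0 ≤ r) (hv : 0 ≤ v) :
    ∫⁻ s in Ioo 0 v, ENNReal.ofReal (r * Real.exp (-(r * (1 - s)))) *
        ENNReal.ofReal (1 / (Real.pi * √((v - s) * (1 - v)))) =
      ENNReal.ofReal (√r * Real.exp (r * (v - 1)) * lowerGamma (1 / 2) (r * v) /
        (Real.pi * √(1 - v))) := by
  have hint := (intervalIntegrable_iff_integrableOn_Ioc_of_le hv).1
    (intervalIntegrable_exp_div_sqrt_sub r hv)
  have hintegrand (s) (hs : s ∈ Ioo 0 v) : ENNReal.ofReal (r * Real.exp (-(r * (1 - s)))) *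
      ENNReal.ofReal (1 / (Real.pi * √((v - s) * (1 - v)))) =
      ENNReal.ofReal (r * Real.exp (-r) / (Real.pi * √(1 - v)) *
        (Real.exp (r * s) / √(v - s))) := by
    rw [← ENNReal.ofReal_mul (by positivity), Real.sqrt_mul (sub_nonneg.2 hs.2.le),
      show -(r * (1 - s)) = -r + r * s by ring, Real.exp_add]
    congr 1
    ring
  have hvalue : r * Real.exp (-r) * ∫ s in (0 : ℝ)..v, Real.exp (r * s) / √(v - s) =
      √r * Real.exp (r * (v - 1)) * lowerGamma (1 / 2) (r * v) := by
    calc r * Real.exp (-r) * ∫ s in (0 : ℝ)..v, Real.exp (r * s) / √(v - s)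
        = √r * Real.exp (-r) * (√r * ∫ s in (0 : ℝ)..v, Real.exp (r * s) / √(v - s)) := by
          nth_rewrite 1 [← Real.mul_self_sqrt hr]
          ring
      _ = √r * Real.exp (r * (v - 1)) * lowerGamma (1 / 2) (r * v) := by
          rw [sqrt_mul_integral_exp_div_sqrt_sub hr hv,
            show r * (v - 1) = -r + r * v by ring, Real.exp_add]
          ring
  rw [setLIntegral_congr_fun measurableSet_Ioo hintegrand,
    ← ofReal_integral_eq_lintegral_ofReal ((hint.mono_set Ioo_subset_Ioc_self).const_mul _)
      (ae_of_all _ fun s => by positivity), ← integral_Ioc_eq_integral_Ioo,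
    ← intervalIntegral.integral_of_le hv, intervalIntegral.integral_const_mul, div_mul_eq_mul_div,
    hvalue]

/-- The density `v ↦ arcsineKernel s v` of `arcsineLaw s` on `(-∞, 1)`, as a jointly measurable
function of `s` and `v`; its support condition `s < v` is encoded as an indicator in `s`. -/
noncomputable def arcsineKernel (s v : ℝ) : ℝ≥0∞ :=
  (Iio v).indicator (fun s => ENNReal.ofReal (1 / (Real.pi * √((v - s) * (1 - v))))) s

theorem measurable_arcsineKernel : Measurable (Function.uncurry arcsineKernel) :=
  .ite (measurableSet_lt measurable_fst measurable_snd) (by fun_prop) measurable_const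

theorem setLIntegral_arcsineKernel {s : ℝ} (hs : 0 ≤ s) {A : Set ℝ} (hA : MeasurableSet A) :
    ∫⁻ v in Ioo 0 1 ∩ A, arcsineKernel s v = arcsineLaw s A := by
  have hindicator (v : ℝ) : arcsineKernel s v = (Ioi s).indicator
      (fun v => ENNReal.ofReal (1 / (Real.pi * √((v - s) * (1 - v))))) v := rfl
  have hset : Ioi s ∩ (Ioo 0 1 ∩ A) = A ∩ Ioo s 1 := by
    ext v
    exact ⟨fun h => ⟨h.2.2, h.1, h.2.1.2⟩, fun h => ⟨h.2.1, ⟨hs.trans_lt h.2.1, h.2.2⟩, h.1⟩⟩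
  simp only [hindicator]
  rw [setLIntegral_indicator measurableSet_Ioi, hset, arcsineLaw, withDensity_apply _ hA,
    Measure.restrict_restrict hA]

theorem lintegral_arcsineKernel_lastResetLaw {r v : ℝ} (hr : 0 ≤ r) (hv : v ∈ Ioo (0 : ℝ) 1) :
    ∫⁻ s, arcsineKernel s v ∂lastResetLaw r = ENNReal.ofReal (lastZeroPDF r v) := by
  have hm : Measurable fun s => arcsineKernel s v :=
    measurable_arcsineKernel.comp (by fun_prop : Measurable fun s : ℝ => (s, v))
  have hset : Iio v ∩ Ioo 0 1 = Ioo 0 v := by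
    rw [inter_comm, Ioo_inter_Iio, min_eq_right hv.2.le]
  have hγ := lowerGamma_nonneg (1 / 2) (mul_nonneg hr hv.1.le)
  have hac : ∫⁻ s, arcsineKernel s v ∂(volume.restrict (Ioo 0 1)).withDensity
      (fun s => ENNReal.ofReal (r * Real.exp (-(r * (1 - s))))) = ENNReal.ofReal
        (√r * Real.exp (r * (v - 1)) * lowerGamma (1 / 2) (r * v) / (Real.pi * √(1 - v))) := by
    have hmul (s : ℝ) : ENNReal.ofReal (r * Real.exp (-(r * (1 - s)))) * arcsineKernel s v =
        (Iio v).indicator (fun s => ENNReal.ofReal (r * Real.exp (-(r * (1 - s)))) *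
          ENNReal.ofReal (1 / (Real.pi * √((v - s) * (1 - v))))) s :=
      (indicator_mul_right (i := s) (Iio v)
        (fun s => ENNReal.ofReal (r * Real.exp (-(r * (1 - s)))))
        fun s => ENNReal.ofReal (1 / (Real.pi * √((v - s) * (1 - v))))).symm
    rw [lintegral_withDensity_eq_lintegral_mul _ (by fun_prop) hm]
    simp only [Pi.mul_apply, hmul]
    rw [setLIntegral_indicator measurableSet_Iio, hset,
      setLIntegral_mul_exp_mul_arcsine hr hv.1.le]
  rw [lastResetLaw, lintegral_add_measure, lintegral_smul_measure, lintegral_dirac' _ hm, hac,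
    arcsineKernel, indicator_of_mem (by exact hv.1), smul_eq_mul,
    ← ENNReal.ofReal_mul (Real.exp_nonneg _), sub_zero, mul_one_div,
    ← ENNReal.ofReal_add (by positivity) (by positivity), lastZeroPDF]

theorem lawOfDensity_lastZeroPDF_apply {r : ℝ} (hr : 0 ≤ r) {A : Set ℝ} (hA : MeasurableSet A) :
    lawOfDensity (lastZeroPDF r) A = ∫⁻ s, arcsineLaw s A ∂lastResetLaw r := by
  rw [lawOfDensity, withDensity_apply _ hA, Measure.restrict_restrict hA, inter_comm,
    setLIntegral_congr_fun (measurableSet_Ioo.inter hA) fun v hv =>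
      (lintegral_arcsineKernel_lastResetLaw hr hv.1).symm,
    ← lintegral_lintegral_swap measurable_arcsineKernel.aemeasurable]
  exact lintegral_congr_ae <| (ae_lastResetLaw_mem_Ico r).mono fun s hs =>
    setLIntegral_arcsineKernel hs.1 hA

theorem isProbabilityMeasure_lawOfDensity_lastZeroPDF {r : ℝ} (hr : 0 ≤ r) :
    IsProbabilityMeasure (lawOfDensity (lastZeroPDF r)) := by
  have := isProbabilityMeasure_lastResetLaw hr
  have hone : ∀ᵐ s ∂lastResetLaw r, arcsineLaw s univ = 1 :=
    (ae_lastResetLaw_mem_Ico r).mono fun s hs =>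
      (isProbabilityMeasure_arcsineLaw hs.2).measure_univ
  constructor
  rw [lawOfDensity_lastZeroPDF_apply hr .univ, lintegral_congr_ae hone, lintegral_one, measure_univ]

theorem isProbabilityMeasure_lawOfDensity_arcsinePDF :
    IsProbabilityMeasure (lawOfDensity arcsinePDF) :=
  lawOfDensity_arcsinePDF ▸ isProbabilityMeasure_arcsineLaw one_pos

theorem arcsinePDF_nonneg (t : ℝ) : 0 ≤ arcsinePDF t := by
  unfold arcsinePDF
  positivity

theorem resetPDF_nonneg {r t : ℝ} (hr : 0 ≤ r) (ht : 0 ≤ t) : 0 ≤ resetPDF r t := by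
  have hγ := lowerGamma_nonneg (1 / 2) (mul_nonneg hr ht)
  have hexp : 0 ≤ Real.exp r - 1 := sub_nonneg.2 (Real.one_le_exp hr)
  unfold resetPDF
  positivity

theorem lastZeroPDF_eq_mixture {r : ℝ} (hr : r ≠ 0) (t : ℝ) :
    lastZeroPDF r t = Real.exp (-r) * arcsinePDF t + (1 - Real.exp (-r)) * resetPDF r t := by
  have hexp : Real.exp r - 1 ≠ 0 := sub_ne_zero.2 (Real.exp_eq_one_iff r |>.not.2 hr)
  have hweight : 1 - Real.exp (-r) = Real.exp (-r) * (Real.exp r - 1) := by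
    rw [mul_sub, ← Real.exp_add, neg_add_cancel, Real.exp_zero, mul_one]
  rw [lastZeroPDF, arcsinePDF, resetPDF, mul_one_div, hweight,
    show r * (t - 1) = -r + r * t by ring, Real.exp_add]
  congr 1
  field_simp

theorem lawOfDensity_lastZeroPDF_eq_mixture {r : ℝ} (hr : 0 < r) :
    lawOfDensity (lastZeroPDF r) =
      ENNReal.ofReal (Real.exp (-r)) • lawOfDensity arcsinePDF +
        ENNReal.ofReal (1 - Real.exp (-r)) • lawOfDensity (resetPDF r) := by
  have hm : Measurable fun t => ENNReal.ofReal (arcsinePDF t) := by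
    unfold arcsinePDF
    fun_prop
  have hweight : 0 ≤ 1 - Real.exp (-r) := by simpa using hr.le
  unfold lawOfDensity
  rw [← withDensity_smul _ hm, ← withDensity_smul' _ _ ENNReal.ofReal_ne_top,
    ← withDensity_add_left (hm.const_smul _)]
  refine withDensity_congr_ae ?_
  filter_upwards [ae_restrict_mem measurableSet_Ioo] with t ht
  rw [lastZeroPDF_eq_mixture hr.ne', ENNReal.ofReal_add
    (mul_nonneg (Real.exp_nonneg _) (arcsinePDF_nonneg t))
    (mul_nonneg hweight (resetPDF_nonneg hr.le ht.1.le)), ENNReal.ofReal_mul (Real.exp_nonneg _),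
    ENNReal.ofReal_mul hweight]
  rfl

theorem isProbabilityMeasure_lawOfDensity_resetPDF {r : ℝ} (hr : 0 < r) :
    IsProbabilityMeasure (lawOfDensity (resetPDF r)) := by
  have hlt : Real.exp (-r) < 1 := by simpa using hr
  have hweight : ENNReal.ofReal (1 - Real.exp (-r)) ≠ 0 := by simpa using hlt
  have htotal := (isProbabilityMeasure_lawOfDensity_lastZeroPDF hr.le).measure_univ
  rw [lawOfDensity_lastZeroPDF_eq_mixture hr, Measure.add_apply, Measure.smul_apply,
    Measure.smul_apply, isProbabilityMeasure_lawOfDensity_arcsinePDF.measure_univ, smul_eq_mul,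
    smul_eq_mul, mul_one] at htotal
  have hone : ENNReal.ofReal (Real.exp (-r)) + ENNReal.ofReal (1 - Real.exp (-r)) = 1 := by
    rw [← ENNReal.ofReal_add (Real.exp_nonneg _) (sub_nonneg.2 hlt.le), add_sub_cancel,
      ENNReal.ofReal_one]
  rw [← hone, ENNReal.add_right_inj ENNReal.ofReal_ne_top] at htotal
  exact ⟨(ENNReal.mul_right_inj hweight ENNReal.ofReal_ne_top).1 (htotal.trans (mul_one _).symm)⟩

end Mixture

/-! ### The law of the last zero -/

section Law

variable {Ω : Type*} {mΩ : MeasurableSpace Ω} {P : Measure Ω}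

section Poisson

variable {N : ℝ≥0 → Ω → ℕ} {r : ℝ≥0}

theorem IsPoissonProcess.measure_apply_eq (hN : IsPoissonProcess N r P) {s t : ℝ≥0} (hst : s ≤ t) :
    P {ω | N s ω = N t ω} = ENNReal.ofReal (Real.exp (-(r * (t - s) : ℝ))) := by
  have hstat := (hN.stationary s (t - s)).measure_mem_eq (measurableSet_singleton (0 : ℤ))
  rw [add_tsub_cancel_of_le hst] at hstat
  calc P {ω | N s ω = N t ω}
      = P ((fun ω => (N t ω : ℤ) - N s ω) ⁻¹' {0}) := by
        congr 1 with ω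
        simp only [mem_ofPred_eq, mem_preimage, mem_singleton_iff]
        omega
    _ = P ((fun ω => (N (t - s) ω : ℤ) - N 0 ω) ⁻¹' {0}) := hstat
    _ = P {ω | N (t - s) ω ∈ ({0} : Set ℕ)} := by
        refine measure_congr (hN.zero.mono fun ω hω => propext ?_)
        change (N (t - s) ω : ℤ) - N 0 ω ∈ ({0} : Set ℤ) ↔ N (t - s) ω ∈ ({0} : Set ℕ)
        simp [hω]
    _ = poissonMeasure (r * (t - s)) {0} :=
        (hN.law (t - s)).measure_eq (p := (· ∈ ({0} : Set ℕ))) (measurableSet_singleton 0)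
    _ = ENNReal.ofReal (Real.exp (-(r * (t - s) : ℝ))) := by
        simp [poissonMeasure_singleton, NNReal.coe_sub hst]

theorem IsPoissonProcess.aemeasurable_lastReset (hN : IsPoissonProcess N r P) :
    AEMeasurable (fun ω => lastReset fun t => N t ω) P := by
  refine AEMeasurable.iInf fun i => ?_
  have hg : Measurable fun p : ℕ × ℕ => if p.1 = p.2 then min (denseSeq ℝ≥0 i) 1 else 1 :=
    .of_discrete
  exact hg.comp_aemeasurable ((hN.law _).aemeasurable.prodMk (hN.law 1).aemeasurable)

theorem IsPoissonProcess.hasLaw_lastReset (hN : IsPoissonProcess N r P) :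
    HasLaw (fun ω => (lastReset (fun t => N t ω) : ℝ)) (lastResetLaw r) P := by
  have := (hN.law 0).isProbabilityMeasure
  have hm : AEMeasurable (fun ω => (lastReset (fun t => N t ω) : ℝ)) P :=
    hN.aemeasurable_lastReset.coe_nnreal_real
  have := Measure.isProbabilityMeasure_map (μ := P) hm
  refine ⟨hm, Measure.ext_of_Iic _ _ fun a => ?_⟩
  rw [Measure.map_apply_of_aemeasurable hm measurableSet_Iic]
  rcases lt_or_ge a 0 with ha | ha
  · rw [lastResetLaw_Iic_of_neg _ ha]
    exact measure_mono_null (fun ω hω => (ha.not_ge ((NNReal.coe_nonneg _).trans hω)).elim)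
      measure_empty
  lift a to ℝ≥0 using ha
  have hconst := hN.measure_apply_eq (min_le_right a 1)
  push_cast at hconst
  rw [lastResetLaw_Iic r.coe_nonneg a.coe_nonneg, ← hconst]
  refine measure_congr ?_
  filter_upwards [hN.monotone, hN.rightCont] with ω hmono hright
  refine propext ?_
  change (lastReset (fun t => N t ω) : ℝ) ≤ a ↔ N (min a 1) ω = N 1 ω
  rw [NNReal.coe_le_coe, lastReset_eq_jumpTime hmono hright,
    ← jumpTime_apply_le_iff (n := fun t => N t ω) hmono hright (min_le_right a 1), le_min_iff,
    and_iff_left (jumpTime_apply_le (fun t => N t ω) 1)]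

end Poisson

theorem hasLaw_of_measure_Iio [IsProbabilityMeasure P] {f : Ω → ℝ} {ν : Measure ℝ}
    [IsProbabilityMeasure ν] (hf : ∀ t, NullMeasurableSet (f ⁻¹' Iio t) P)
    (hν : ∀ t, P (f ⁻¹' Iio t) = ν (Iio t)) : HasLaw f ν P := by
  have hm : AEMeasurable f P :=
    NullMeasurable.aemeasurable (measurable_of_Iio (δ := NullMeasurableSpace Ω P) hf)
  have := Measure.isProbabilityMeasure_map (μ := P) hm
  refine ⟨hm, Measure.ext_of_Ici _ _ fun t => ?_⟩
  rw [← compl_Iio, prob_compl_eq_one_sub measurableSet_Iio, prob_compl_eq_one_sub measurableSet_Iio,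
    Measure.map_apply_of_aemeasurable hm measurableSet_Iio, hν]

section Brownian

/-- The pairs of a time `s` and a path `b` which does not take on `[t, 1]` its value at time `s`. -/
def noReturnSet (t : ℝ≥0) : Set (ℝ≥0 × ContinuousPath) :=
  {p | ¬ ∃ u ∈ Icc t 1, p.2.1 u = p.2.1 p.1}

theorem measurableSet_noReturnSet (t : ℝ≥0) : MeasurableSet (noReturnSet t) :=
  (measurableSet_exists_mem_Icc_eq t 1).compl

variable {β : Ω → ContinuousPath} {T : Ω → ℝ≥0}

theorem measure_mk_mem_noReturnSet (hβ : Measurable β)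
    (hW : IsPreBrownianReal (fun t ω => (β ω).1 t) P) {s : ℝ≥0} (hs : s < 1) (t : ℝ≥0) :
    P {ω | (s, β ω) ∈ noReturnSet t} = arcsineLaw s (Iio t) := by
  have := hW.isGaussianProcess.isProbabilityMeasure
  have hs' : (s : ℝ) < 1 := by exact_mod_cast hs
  rw [arcsineLaw_Iio hs']
  change P {ω | ¬ ∃ u ∈ Icc t 1, (β ω).1 u = (β ω).1 s} = _
  rcases le_or_gt t s with hts | hst
  · have hsqrt : √(((t : ℝ) - s) / (1 - s)) = 0 := Real.sqrt_eq_zero_of_nonpos <|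
      div_nonpos_of_nonpos_of_nonneg (sub_nonpos.2 (NNReal.coe_le_coe.2 hts)) (sub_pos.2 hs').le
    have hreturn (ω : Ω) : ∃ u ∈ Icc t 1, (β ω).1 u = (β ω).1 s := ⟨s, ⟨hts, hs.le⟩, rfl⟩
    simp only [hreturn, not_true_eq_false, ofPred_false, measure_empty, hsqrt, Real.arcsin_zero,
      mul_zero, ENNReal.ofReal_zero]
  rcases le_or_gt t 1 with ht | ht
  · have hWm (u : ℝ≥0) : Measurable fun ω => (β ω).1 u :=
      (measurable_pi_apply u).comp (measurable_subtype_coe.comp hβ)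
    rw [← ofReal_measureReal, measureReal_not_exists_return hW hWm (fun ω => (β ω).2) hst ht,
      NNReal.coe_one]
  · have hsqrt : 1 ≤ √(((t : ℝ) - s) / (1 - s)) := Real.one_le_sqrt.2 <|
      (one_le_div (sub_pos.2 hs')).2 (sub_le_sub_right (by exact_mod_cast ht.le) _)
    simp [Icc_eq_empty ht.not_ge, Real.arcsin_of_one_le hsqrt]

theorem measure_preimage_noReturnSet (hβ : Measurable β)
    (hW : IsPreBrownianReal (fun t ω => (β ω).1 t) P) (hT : AEMeasurable T P)
    (hT1 : ∀ᵐ ω ∂P, T ω < 1) (hind : IndepFun T β P) (t : ℝ≥0) :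
    P ((fun ω => (T ω, β ω)) ⁻¹' noReturnSet t) = ∫⁻ ω, arcsineLaw (T ω) (Iio t) ∂P := by
  have := hW.isGaussianProcess.isProbabilityMeasure
  have hA := measurableSet_noReturnSet t
  calc P ((fun ω => (T ω, β ω)) ⁻¹' noReturnSet t)
      = ∫⁻ s, P.map β (Prod.mk s ⁻¹' noReturnSet t) ∂P.map T := by
        rw [← Measure.map_apply_of_aemeasurable (hT.prodMk hβ.aemeasurable) hA,
          (indepFun_iff_map_prod_eq_prod_map_map hT hβ.aemeasurable).1 hind, Measure.prod_apply hA]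
    _ = ∫⁻ ω, P.map β (Prod.mk (T ω) ⁻¹' noReturnSet t) ∂P :=
        lintegral_map' (measurable_measure_prodMk_left hA).aemeasurable hT
    _ = ∫⁻ ω, arcsineLaw (T ω) (Iio t) ∂P := lintegral_congr_ae <| hT1.mono fun ω hω =>
        (Measure.map_apply hβ (measurable_prodMk_left hA)).trans
          (measure_mk_mem_noReturnSet hβ hW hω t)

end Brownian

theorem indepFun_coe_subtype_iff {E F : Type*} [MeasurableSpace E] [MeasurableSpace F]
    {p : F → Prop} {f : Ω → E} {g : Ω → Subtype p} :
    IndepFun f (fun ω => (g ω : F)) P ↔ IndepFun f g P := by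
  rw [IndepFun_iff_Indep, IndepFun_iff_Indep, Subtype.instMeasurableSpace,
    MeasurableSpace.comap_comp]
  rfl

theorem IsResetBrownian.exists_lastZero_lt_iff {r : ℝ≥0}
    {X : ℝ≥0 → Ω → ℝ} (hX : IsResetBrownian X r P) :
    ∃ (T : Ω → ℝ≥0) (β : Ω → ContinuousPath), AEMeasurable T P ∧ Measurable β ∧ IndepFun T β P ∧
      HasLaw (fun ω => (T ω : ℝ)) (lastResetLaw r) P ∧
      IsPreBrownianReal (fun t ω => (β ω).1 t) P ∧
      ∀ᵐ ω ∂P, ∀ t : ℝ≥0, lastZero (X · ω) < t ↔ (T ω, β ω) ∈ noReturnSet t := by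
  obtain ⟨B, N, hB, hN, hBN, hXBN⟩ := hX
  obtain ⟨W, hWm, hWc, hWB⟩ := exists_measurable_continuous_version hB.aemeasurable hB.cont
  have hind : IndepFun (fun ω => lastReset fun t => N t ω) (fun ω t => W t ω) P :=
    (hBN.symm.comp measurable_lastReset measurable_id).congr (ae_eq_refl _)
      (hWB.mono fun ω h => (funext h).symm)
  refine ⟨fun ω => lastReset fun t => N t ω, fun ω => ⟨(W · ω), hWc ω⟩, hN.aemeasurable_lastReset,
    (measurable_pi_lambda _ hWm).subtype_mk, indepFun_coe_subtype_iff.1 hind, hN.hasLaw_lastReset,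
    hB.toIsPreBrownianReal.congr fun t => hWB.mono fun ω h => (h t).symm, ?_⟩
  filter_upwards [hWB, hN.monotone, hN.rightCont, hXBN] with ω hW hmono hright hX t
  have hXW : (X · ω) = resetPath (W · ω) (N · ω) :=
    funext fun u => (hX u).trans (by simp only [resetPath, hW])
  rw [hXW, lastZero_resetPath_lt_iff hmono hright (hWc ω), ← lastReset_eq_jumpTime hmono hright]
  rfl

theorem lintegral_arcsineLaw_comp {r : ℝ≥0} {T : Ω → ℝ≥0}
    (hT : HasLaw (fun ω => (T ω : ℝ)) (lastResetLaw r) P) {A : Set ℝ} (hA : MeasurableSet A) :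
    ∫⁻ ω, arcsineLaw (T ω) A ∂P = lawOfDensity (lastZeroPDF r) A := by
  have hm : AEMeasurable (fun s => arcsineLaw s A) (lastResetLaw r) :=
    measurable_arcsineKernel.lintegral_prod_right'.aemeasurable.congr <|
      (ae_lastResetLaw_mem_Ico r).mono fun s hs => setLIntegral_arcsineKernel hs.1 hA
  rw [hT.lintegral_comp hm, lawOfDensity_lastZeroPDF_apply r.coe_nonneg hA]

theorem lawOfDensity_Iio_of_nonpos (p : ℝ → ℝ) {t : ℝ} (ht : t ≤ 0) :
    lawOfDensity p (Iio t) = 0 := by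
  rw [lawOfDensity, withDensity_apply _ measurableSet_Iio,
    Measure.restrict_restrict measurableSet_Iio, inter_comm, Ioo_inter_Iio,
    Ioo_eq_empty ((min_le_right _ _).trans ht).not_gt, setLIntegral_empty]

theorem hasLaw_lastZero {r : ℝ≥0} {X : ℝ≥0 → Ω → ℝ}
    (hX : IsResetBrownian X r P) :
    HasLaw (fun ω => lastZero (X · ω)) (lawOfDensity (lastZeroPDF r)) P := by
  have := isProbabilityMeasure_lawOfDensity_lastZeroPDF r.coe_nonneg
  obtain ⟨T, β, hT, hβ, hind, hTlaw, hW, hiff⟩ := hX.exists_lastZero_lt_iff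
  have := hW.isGaussianProcess.isProbabilityMeasure
  have hT1 : ∀ᵐ ω ∂P, T ω < 1 :=
    (hTlaw.ae_iff (p := (· < 1)) (by fun_prop)).2 <|
      (ae_lastResetLaw_mem_Ico r).mono fun s hs => hs.2
  have hevent (t : ℝ≥0) : (fun ω => (T ω, β ω)) ⁻¹' noReturnSet t =ᵐ[P]
      (fun ω => lastZero (X · ω)) ⁻¹' Iio (t : ℝ) :=
    hiff.mono fun ω h => propext (h t).symm
  have hneg {t : ℝ} (ht : t < 0) : (fun ω => lastZero (X · ω)) ⁻¹' Iio t = ∅ :=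
    eq_empty_of_forall_notMem fun ω hω => ((lt_trans hω ht).not_ge (NNReal.coe_nonneg _))
  refine hasLaw_of_measure_Iio (fun t => ?_) fun t => ?_ <;> rcases lt_or_ge t 0 with ht | ht
  · exact hneg ht ▸ nullMeasurableSet_empty
  · lift t to ℝ≥0 using ht
    exact ((hT.prodMk hβ.aemeasurable).nullMeasurableSet_preimage
      (measurableSet_noReturnSet t)).congr (hevent t)
  · rw [hneg ht, measure_empty, lawOfDensity_Iio_of_nonpos _ ht.le]
  · lift t to ℝ≥0 using ht
    rw [← measure_congr (hevent t), measure_preimage_noReturnSet hβ hW hT hT1 hind,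
      lintegral_arcsineLaw_comp hTlaw measurableSet_Iio]

end Law

end ResetBM

theorem mainTheorem4 {Ω : Type*} [MeasurableSpace Ω] (P : Measure Ω) [IsProbabilityMeasure P]
    (r : ℝ≥0) (hr : 0 < r) (X : ℝ≥0 → Ω → ℝ) (hX : ResetBM.IsResetBrownian X r P) :
    -- the last zero has the density `lastZeroPDF r` on `(0,1)`
    HasLaw (fun ω => ResetBM.lastZero (fun t => X t ω))
      (ResetBM.lawOfDensity (ResetBM.lastZeroPDF r)) P ∧
    -- both components of the mixture are nonnegative probability densities
    (∀ t ∈ Ioo (0 : ℝ) 1, 0 ≤ ResetBM.arcsinePDF t ∧ 0 ≤ ResetBM.resetPDF r t) ∧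
    IsProbabilityMeasure (ResetBM.lawOfDensity ResetBM.arcsinePDF) ∧
    IsProbabilityMeasure (ResetBM.lawOfDensity (ResetBM.resetPDF r)) ∧
    -- the density is the mixture with weights `e^{-r}` and `1 - e^{-r}`
    (∀ t ∈ Ioo (0 : ℝ) 1, ResetBM.lastZeroPDF r t =
      Real.exp (-r) * ResetBM.arcsinePDF t + (1 - Real.exp (-r)) * ResetBM.resetPDF r t) ∧
    -- hence so is the law
    HasLaw (fun ω => ResetBM.lastZero (fun t => X t ω))
      (ENNReal.ofReal (Real.exp (-r)) • ResetBM.lawOfDensity ResetBM.arcsinePDF +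
        ENNReal.ofReal (1 - Real.exp (-r)) • ResetBM.lawOfDensity (ResetBM.resetPDF r)) P := by
  have hr' : (0 : ℝ) < r := NNReal.coe_pos.2 hr
  have hlaw := ResetBM.hasLaw_lastZero hX
  exact ⟨hlaw, fun t ht => ⟨ResetBM.arcsinePDF_nonneg t, ResetBM.resetPDF_nonneg hr'.le ht.1.le⟩,
    ResetBM.isProbabilityMeasure_lawOfDensity_arcsinePDF,
    ResetBM.isProbabilityMeasure_lawOfDensity_resetPDF hr',
    fun t _ => ResetBM.lastZeroPDF_eq_mixture hr'.ne' t,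
    ResetBM.lawOfDensity_lastZeroPDF_eq_mixture hr' ▸ hlaw⟩
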